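/- For rational numbers $a,b$ and a prime $p$, write $a\equiv b \pmod p$ if $a-b=p\,c$ for some rational number $c$ whose denominator is not divisible by $p$ ($a$ and $b$ themselves may have denominators divisible by $p$). For $n\ge 0$ let $H_n(1)=\sum_{k=1}^{n}\frac1k$. Then for every prime $p>5$, $$\sum_{k=1}^{p-1}\frac{1}{k^4\binom{2k}{k}}\equiv\frac{H_{p-1}(1)}{p^3}\pmod p,$$ and for every prime $p>3$, $$\sum_{k=1}^{p-1}\frac{\binom{2k}{k}}{k^3}\equiv\frac{-2H_{p-1}(1)}{p^2}\pmod p.$$ -/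

import Mathlib

/-- Congruence of rational numbers modulo a natural number `m`: `a ≡ b (mod m)` means that
`a - b` is `m` times a fraction whose denominator is coprime to `m`. For `m = p` a prime this says
`a - b ∈ p ℤ_(p)`. Neither `a` nor `b` is required to be `p`-integral by itself. -/
def RatModEq (m : ℕ) (a b : ℚ) : Prop :=
  ∃ c : ℚ, Nat.Coprime c.den m ∧ a - b = (m : ℚ) * c

open Finset

/-! Write I_s = ∑ 1/(k^s C(2k,k)), S = ∑ (∑_{m<k} 1/m²)/(k² C(2k,k)), A = ∑ (-1)^(k-1)/k², R = ∑
(∑_{m<k} 1/m²)/(p-k) and H_s = ∑ 1/k^s, all over 1 ≤ k ≤ p-1. The first congruence says p³ I_4 ≡ H_1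
mod p⁴, and I_4 is isolated by eliminating every other sum from six linear congruences mod p⁴ (after
scaling by p where needed).

Three of them come from finite Apéry-like identities. `sum_alternating_inv_sub` relates alternating
sums to inverse central binomial sums with a parameter x; at x = 0 it gives A, I_2, H_1, R, and at x
= p² it brings in I_4 and S. `three_mul_sum_oddTerm` at r = p relates I_2, I_4, S, H_2. A fourth
comes from the symmetry of the shifted Legendre polynomial of degree p and ties R to H_1 and H_2.
The last two are Wolstenholme-type: 2H_1 + pH_2 ≡ 0 mod p⁴ and 4A + 3H_2 ≡ 0 mod p³. The elimination
is `powDvd_invBinomSum_four`.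

The second congruence follows from the first by pairing k with p - k: for 2k < p one has k C(2k,k)
C(2(p-k),p-k) ≡ -2p mod p², hence ∑ C(2k,k)/k³ ≡ -2p I_4 mod p. The prime 5 is checked numerically.
-/

/-! ### A finite identity for alternating sums with a parameter x -/

/-- The partial product `∏_{m=1}^{k} (m² - x)`. -/
def sqProd (x : ℚ) (k : ℕ) : ℚ := ∏ m ∈ range k, (((m : ℚ) + 1) ^ 2 - x)

lemma sqProd_zero (x : ℚ) : sqProd x 0 = 1 := by simp [sqProd]

lemma sqProd_succ (x : ℚ) (k : ℕ) :
    sqProd x (k + 1) = sqProd x k * (((k : ℚ) + 1) ^ 2 - x) := by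
  simp [sqProd, prod_range_succ]

/-- A telescoping sum. At K = N it evaluates the change of the remainder of
`sum_alternating_inv_sub` when N grows by one. -/
lemma sum_sqProd_factorial (x : ℚ) (N : ℕ) (hx : ((N : ℚ) + 1) ^ 2 - x ≠ 0) (K : ℕ) (hK : K ≤ N) :
    ∑ k ∈ range K, (-1 : ℚ) ^ (k + 1) * sqProd x k * (N + 1) * (N - 1 - k).factorial
        / (N + k + 2).factorial
      = - 1 / (((N : ℚ) + 1) ^ 2 - x)
        + (-1) ^ K * sqProd x K * (N + 1) * (N - K).factorial
          / ((N + 1 + K).factorial * (((N : ℚ) + 1) ^ 2 - x)) := by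
  induction K with
  | zero =>
    simp only [range_zero, sum_empty, pow_zero, sqProd_zero, Nat.sub_zero, add_zero,
      Nat.factorial_succ]
    have : (N.factorial : ℚ) ≠ 0 := by positivity
    have : (N : ℚ) + 1 ≠ 0 := by positivity
    push_cast
    field_simp
    ring
  | succ K ih =>
    rw [sum_range_succ, ih (by omega), sqProd_succ]
    obtain ⟨d, rfl⟩ : ∃ d, N = K + 1 + d := ⟨N - (K + 1), by omega⟩
    have e1 : K + 1 + d - K = d + 1 := by omega
    have e2 : K + 1 + d - 1 - K = d := by omega
    have e3 : K + 1 + d - (K + 1) = d := by omega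
    have e5 : K + 1 + d + 1 + K = (K + 1 + d + K + 1) := by ring
    have e6 : K + 1 + d + K + 2 = (K + 1 + d + K + 1) + 1 := by ring
    have e4 : K + 1 + d + 1 + (K + 1) = (K + 1 + d + K + 1) + 1 := by ring
    rw [e1, e2, e3, e4, e5, e6, Nat.factorial_succ d, Nat.factorial_succ (K + 1 + d + K + 1)]
    have h1 : ((K + 1 + d + K + 1).factorial : ℚ) ≠ 0 := by positivity
    have h2 : ((K : ℚ) + 1 + d + K + 1 + 1) ≠ 0 := by positivity
    push_cast at hx ⊢
    field_simp
    ring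

/-- Induction on N. The change in the old remainder terms supplies the new alternating term; its
boundary part, together with the new remainder term k = N, matches the new binomial term. -/
lemma sum_alternating_inv_sub (x : ℚ) (N : ℕ) (hx : ∀ n < N, ((n : ℚ) + 1) ^ 2 - x ≠ 0) :
    ∑ n ∈ range N, (-1 : ℚ) ^ n / (((n : ℚ) + 1) ^ 2 - x)
      = ∑ k ∈ range N, sqProd x k / (k.factorial : ℚ) ^ 2 / (k + 1).centralBinom
          * (2 / (((k : ℚ) + 1) ^ 2 - x) - 1 / (2 * ((k : ℚ) + 1) ^ 2))
        + 1 / 2 * ∑ k ∈ range N, (-1 : ℚ) ^ (N + k + 1) * sqProd x k * (N - 1 - k).factorial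
            / (N + k + 1).factorial := by
  induction N with
  | zero => simp
  | succ N ih =>
    rw [sum_range_succ, sum_range_succ _ N, ih fun n hn => hx n (by omega), sum_range_succ _ N]
    have hxN := hx N (by omega)
    have key := sum_sqProd_factorial x N hxN N le_rfl
    have step : ∑ k ∈ range N, (-1 : ℚ) ^ (N + 1 + k + 1) * sqProd x k
          * (N + 1 - 1 - k).factorial / (N + 1 + k + 1).factorial
        = ∑ k ∈ range N, (-1 : ℚ) ^ (N + k + 1) * sqProd x k * (N - 1 - k).factorial
            / (N + k + 1).factorial
          - 2 * (-1) ^ N * ∑ k ∈ range N, (-1 : ℚ) ^ (k + 1) * sqProd x k * (N + 1)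
            * (N - 1 - k).factorial / (N + k + 2).factorial := by
      rw [mul_sum, ← sum_sub_distrib]
      refine sum_congr rfl fun k hk => ?_
      have hk := mem_range.1 hk
      obtain ⟨d, rfl⟩ : ∃ d, N = k + 1 + d := ⟨N - (k + 1), by omega⟩
      have e1 : k + 1 + d + 1 - 1 - k = d + 1 := by omega
      have e2 : k + 1 + d - 1 - k = d := by omega
      have e3 : k + 1 + d + 1 + k + 1 = (k + 1 + d + k + 1) + 1 := by ring
      have e4 : k + 1 + d + k + 2 = (k + 1 + d + k + 1) + 1 := by ring
      rw [e1, e2, e3, e4, Nat.factorial_succ d, Nat.factorial_succ (k + 1 + d + k + 1)]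
      have h1 : ((k + 1 + d + k + 1).factorial : ℚ) ≠ 0 := by positivity
      have h2 : ((k : ℚ) + 1 + d + k + 1 + 1) ≠ 0 := by positivity
      push_cast
      field_simp
      ring
    rw [step, key]
    have e1 : N + 1 - 1 - N = 0 := by omega
    have e2 : N - N = 0 := by omega
    have e3 : N + 1 + N + 1 = 2 * (N + 1) := by ring
    have hf : ((2 * (N + 1)).factorial : ℚ) = (N + 1).centralBinom * ((N + 1) * N.factorial) ^ 2 := by
      have := Nat.choose_mul_factorial_mul_factorial (show N + 1 ≤ 2 * (N + 1) by omega)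
      rw [show 2 * (N + 1) - (N + 1) = N + 1 by omega, ← Nat.centralBinom_eq_two_mul_choose,
        Nat.factorial_succ N] at this
      rw [← this]; push_cast; ring
    have hg : ((N + 1 + N).factorial : ℚ) * (2 * (N + 1)) =
        (N + 1).centralBinom * ((N + 1) * N.factorial) ^ 2 := by
      rw [← hf, show 2 * (N + 1) = (N + 1 + N) + 1 by ring, Nat.factorial_succ]; push_cast; ring
    have hg' : ((N + 1 + N).factorial : ℚ) =
        (N + 1).centralBinom * ((N + 1) * N.factorial) ^ 2 / (2 * (N + 1)) := by
      rw [← hg]; field_simp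
    rw [e1, e2, e3, hf, hg']
    have h1 : (N.factorial : ℚ) ≠ 0 := by positivity
    have h2 : ((N + 1).centralBinom : ℚ) ≠ 0 := by
      exact_mod_cast (Nat.centralBinom_ne_zero _)
    have h3 : (N : ℚ) + 1 ≠ 0 := by positivity
    have s2 : (-1 : ℚ) ^ (2 * (N + 1)) = 1 := by rw [pow_mul]; norm_num
    rw [s2]
    have s3 : (-1 : ℚ) ^ N * (-1) ^ N = 1 := by rw [← mul_pow]; norm_num
    have : (2 : ℚ) * (-1) ^ N * ((-1) ^ N * sqProd x N * (N + 1)) = 2 * (sqProd x N * (N + 1)) := by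
      linear_combination 2 * (sqProd x N * (N + 1)) * s3
    simp only [Nat.factorial_zero, Nat.cast_one, mul_one]
    rw [mul_sub, mul_sub, mul_add (2 * (-1 : ℚ) ^ N), ← mul_div_assoc (2 * (-1 : ℚ) ^ N) (_ * _), this]
    generalize ∑ k ∈ range N, (-1 : ℚ) ^ (N + k + 1) * sqProd x k * (N - 1 - k).factorial
      / (N + k + 1).factorial = A
    generalize ∑ k ∈ range N, sqProd x k / (k.factorial : ℚ) ^ 2 / (k + 1).centralBinom
      * (2 / (((k : ℚ) + 1) ^ 2 - x) - 1 / (2 * ((k : ℚ) + 1) ^ 2)) = B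
    field_simp
    ring

/-- The sum is the shifted Legendre polynomial at 1, which the symmetry X ↦ 1 - X compares with its
value 1 at 0. -/
lemma sum_neg_one_pow_choose_mul_choose (n : ℕ) :
    ∑ k ∈ range (n + 1), (-1 : ℤ) ^ k * n.choose k * (n + k).choose n = (-1) ^ n := by
  have h := congrArg (Polynomial.eval 0) (Polynomial.neg_one_pow_mul_shiftedLegendre_comp_one_sub_X_eq n)
  have h0 : (Polynomial.shiftedLegendre n).eval 0 = 1 := by
    rw [← Polynomial.coeff_zero_eq_eval_zero, Polynomial.coeff_shiftedLegendre]; simp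
  rw [h0] at h
  have h1 : (Polynomial.shiftedLegendre n).eval 1 =
      ∑ k ∈ range (n + 1), (-1 : ℤ) ^ k * n.choose k * (n + k).choose n := by
    rw [Polynomial.shiftedLegendre, Polynomial.eval_finsetSum]
    simp
  rw [← h1]
  simp [Polynomial.eval_comp] at h
  have s3 : (-1 : ℤ) ^ n * (-1) ^ n = 1 := by rw [← mul_pow]; norm_num
  linear_combination (-1) ^ n * h - Polynomial.eval 1 (Polynomial.shiftedLegendre n) * s3

/-! ### A terminating identity at half-integers r/2, r odd -/

lemma sqProd_ne_zero (x : ℚ) (k : ℕ) (h : ∀ m < k, ((m : ℚ) + 1) ^ 2 - x ≠ 0) :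
    sqProd x k ≠ 0 :=
  prod_ne_zero_iff.2 fun m hm => h m (mem_range.1 hm)

lemma sq_sub_odd_sq_div_four_ne_zero {r : ℕ} (hr : Odd r) (m : ℕ) :
    ((m : ℚ) + 1) ^ 2 - (r : ℚ) ^ 2 / 4 ≠ 0 := by
  intro h
  have h1 : (2 * ((m : ℚ) + 1)) ^ 2 = (r : ℚ) ^ 2 := by linear_combination 4 * h
  have h2 : (2 * (m + 1)) ^ 2 = r ^ 2 := by exact_mod_cast h1
  have h3 := Nat.pow_left_injective (n := 2) (by norm_num) h2
  obtain ⟨t, rfl⟩ := hr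
  omega

/-- The product `(r + 1) ⋯ (r + j + 1) · r (r - 1) ⋯ (r - j + 1)`. -/
def risingFalling (r : ℚ) (j : ℕ) : ℚ :=
  (∏ i ∈ range (j + 1), (r + 1 + i)) * ∏ i ∈ range j, (r - i)

lemma risingFalling_succ (r : ℚ) (j : ℕ) :
    risingFalling r (j + 1) = risingFalling r j * ((r + j + 2) * (r - j)) := by
  simp only [risingFalling, prod_range_succ _ (j + 1), prod_range_succ _ j]
  push_cast
  ring

/-- Together with `add_two_mul_sqProd_eq_risingFalling`, this extracts a common factor from the
numerators at r and at r + 2, so that their difference can telescope. -/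
lemma mul_sqProd_eq_risingFalling (r : ℚ) (j : ℕ) :
    r * sqProd (r ^ 2) (j + 1) =
      (-1) ^ (j + 1) * risingFalling r j * (r - j) * (r - j - 1) := by
  induction j with
  | zero => simp [sqProd, risingFalling]; ring
  | succ j ih =>
    rw [sqProd_succ, ← mul_assoc, ih, risingFalling_succ]
    push_cast
    ring

lemma add_two_mul_sqProd_eq_risingFalling (r : ℚ) (j : ℕ) :
    (r + 2) * sqProd ((r + 2) ^ 2) (j + 1) =
      (-1) ^ (j + 1) * risingFalling r j * (r + j + 2) * (r + j + 3) := by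
  induction j with
  | zero => simp [sqProd, risingFalling]; ring
  | succ j ih =>
    rw [sqProd_succ, ← mul_assoc, ih, risingFalling_succ]
    push_cast
    ring

/-- Replacing r/2 by r/2 + 1 shifts the factors m ± r/2 by one place, so only the end factors
change. -/
lemma sqProd_add_two_sq_div_four (r : ℚ) (k : ℕ) :
    sqProd ((r + 2) ^ 2 / 4) k * ((k - r / 2) * (1 + r / 2)) =
      sqProd (r ^ 2 / 4) k * (-r / 2 * (k + 1 + r / 2)) := by
  induction k with
  | zero => simp [sqProd]; ring
  | succ k ih =>
    rw [sqProd_succ, sqProd_succ]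
    push_cast
    linear_combination (k + 2 + r / 2) * (k + 1 - r / 2) * ih

/-- The summand `∏_{m=1}^{k} (m² - r²) / (C(2k+2, k+1) ∏_{m=1}^{k+1} (m² - r²/4))`. -/
def oddTerm (r : ℚ) (k : ℕ) : ℚ :=
  sqProd (r ^ 2) k / ((k + 1).centralBinom * sqProd (r ^ 2 / 4) (k + 1))

lemma sum_oddTerm_sub {r : ℕ} (hr : Odd r) (j : ℕ) :
    ∑ k ∈ range (j + 1), 3 * (((r : ℚ) + 2) / 2 * oddTerm (r + 2) k - r / 2 * oddTerm r k)
      = 2 * (1 + r) * (2 * j + 3) * ((-1) ^ (j + 1) * risingFalling r j)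
          / (r * (j + 2).centralBinom * sqProd (r ^ 2 / 4) (j + 1) * (j + 2 + r / 2))
        - 2 / (r * (r + 2)) := by
  have hr0 : (r : ℚ) ≠ 0 := by
    have := hr.pos
    positivity
  have hne := sq_sub_odd_sq_div_four_ne_zero hr
  have hm : ∀ k : ℕ, (k : ℚ) + 1 - r / 2 ≠ 0 := fun k h =>
    hne k (by linear_combination ((k : ℚ) + 1 + r / 2) * h)
  have hq : ∀ k : ℕ, (k : ℚ) + 1 + r / 2 ≠ 0 := fun k => by positivity
  have hr1 : 1 + (r : ℚ) / 2 ≠ 0 := by positivity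
  have hshift : ∀ k : ℕ, sqProd (((r : ℚ) + 2) ^ 2 / 4) (k + 1) =
      sqProd ((r : ℚ) ^ 2 / 4) (k + 1) * (-r / 2 * (k + 2 + r / 2)) /
        ((k + 1 - r / 2) * (1 + r / 2)) := fun k => by
    have := sqProd_add_two_sq_div_four r (k + 1)
    push_cast at this
    rw [eq_div_iff (mul_ne_zero (hm k) hr1), this]
    ring
  induction j with
  | zero =>
    have h1 := hshift 0
    have hm0 := hm 0
    have hq1 := hq 1
    have hn0 := hne 0
    simp only [zero_add, range_one, sum_singleton, oddTerm, h1]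
    simp only [sqProd, risingFalling, zero_add, range_zero, range_one, prod_empty, prod_singleton]
    have c1 : (Nat.centralBinom 1) = 2 := by decide
    have c2 : (Nat.centralBinom 2) = 6 := by decide
    simp only [c1, c2]
    push_cast at *
    have e1 : (2 : ℚ) - r ≠ 0 := fun h => hm0 (by linear_combination h / 2)
    have e2 : (2 : ℚ) + r ≠ 0 := by positivity
    have e3 : (4 : ℚ) + r ≠ 0 := by positivity
    have e4 : (0 : ℚ) + 1 - r / 2 = (2 - r) / 2 := by ring
    have e5 : (0 : ℚ) + 2 + r / 2 = (4 + r) / 2 := by ring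
    have e6 : (1 : ℚ) + r / 2 = (2 + r) / 2 := by ring
    have e7 : ((0 : ℚ) + 1) ^ 2 - r ^ 2 / 4 = (2 - r) * (2 + r) / 4 := by ring
    have e8 : (r : ℚ) + 2 = 2 + r := by ring
    rw [e4, e5, e6, e7, e8]
    field_simp
    ring
  | succ j ih =>
    rw [sum_range_succ, ih]
    have hc : ((j + 3).centralBinom : ℚ) = 2 * (2 * j + 5) / (j + 3) * (j + 2).centralBinom := by
      have := Nat.succ_mul_centralBinom_succ (j + 2)
      have h2 : ((j : ℚ) + 3) * (j + 3).centralBinom = 2 * (2 * j + 5) * (j + 2).centralBinom := by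
        have h3 : ((j + 2 + 1 : ℕ) : ℚ) * (j + 2 + 1).centralBinom
          = 2 * (2 * ((j + 2 : ℕ) : ℚ) + 1) * (j + 2).centralBinom := by exact_mod_cast this
        push_cast at h3
        linear_combination h3
      have : (j : ℚ) + 3 ≠ 0 := by positivity
      field_simp
      linear_combination h2
    have hN : sqProd ((r : ℚ) ^ 2) (j + 1) =
        (-1) ^ (j + 1) * risingFalling r j * (r - j) * (r - j - 1) / r := by
      rw [← mul_sqProd_eq_risingFalling]; field_simp
    have hN2 : sqProd (((r : ℚ) + 2) ^ 2) (j + 1) =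
        (-1) ^ (j + 1) * risingFalling r j * (r + j + 2) * (r + j + 3) / (r + 2) := by
      rw [← add_two_mul_sqProd_eq_risingFalling]; field_simp
    have hC : ((j + 2).centralBinom : ℚ) ≠ 0 := by exact_mod_cast Nat.centralBinom_ne_zero _
    have hD : sqProd ((r : ℚ) ^ 2 / 4) (j + 1) ≠ 0 := sqProd_ne_zero _ _ fun m _ => hne m
    have hm1 := hm (j + 1)
    have hq1 := hq (j + 1)
    have hq2 := hq (j + 2)
    have hj5 : 2 * (j : ℚ) + 5 ≠ 0 := by positivity
    have hj3 : (j : ℚ) + 3 ≠ 0 := by positivity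
    simp only [oddTerm, hshift, hN, hN2, risingFalling_succ]
    rw [show j + 1 + 1 = j + 2 by ring, show j + 1 + 2 = j + 3 by ring, hc,
      sqProd_succ ((r : ℚ) ^ 2 / 4) (j + 1), pow_succ (-1 : ℚ) (j + 1)]
    generalize sqProd ((r : ℚ) ^ 2 / 4) (j + 1) = D at *
    generalize risingFalling (r : ℚ) j = B at *
    generalize ((j + 2).centralBinom : ℚ) = C at *
    generalize (-1 : ℚ) ^ (j + 1) = s at *
    push_cast at *
    have e1 : 2 * (j : ℚ) + 4 - r ≠ 0 := fun h => hm1 (by linear_combination h / 2)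
    have e2 : 2 * (j : ℚ) + 4 + r ≠ 0 := by positivity
    have e3 : 2 * (j : ℚ) + 6 + r ≠ 0 := by positivity
    have e4 : 2 + (r : ℚ) ≠ 0 := by positivity
    have f1 : (j : ℚ) + 1 + 1 - r / 2 = (2 * j + 4 - r) / 2 := by ring
    have f2 : (j : ℚ) + 2 + r / 2 = (2 * j + 4 + r) / 2 := by ring
    have f3 : (j : ℚ) + 1 + 2 + r / 2 = (2 * j + 6 + r) / 2 := by ring
    have f4 : 1 + (r : ℚ) / 2 = (2 + r) / 2 := by ring
    have f5 : ((j : ℚ) + 1 + 1) ^ 2 - r ^ 2 / 4 = (2 * j + 4 - r) * (2 * j + 4 + r) / 4 := by ring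
    have f6 : (r : ℚ) + 2 = 2 + r := by ring
    rw [f1, f2, f3, f4, f5, f6]
    field_simp
    ring

/-- The case x = r/2 of 3 ∑ ∏(m² - 4x²)/(C(2k,k) ∏(m² - x²)) = ∑ 1/(n² - x²) = (1 - πx cot
πx)/(2x²): the left side terminates and the cotangent vanishes. The proof is an induction r → r + 2
through `sum_oddTerm_sub`. -/
lemma three_mul_sum_oddTerm {r : ℕ} (hr : Odd r) :
    3 * ∑ k ∈ range r, oddTerm r k = 2 / (r : ℚ) ^ 2 := by
  obtain ⟨t, rfl⟩ := hr
  induction t with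
  | zero =>
    have c1 : (Nat.centralBinom 1) = 2 := by decide
    simp [oddTerm, sqProd, c1]
    norm_num
  | succ t ih =>
    have hodd : Odd (2 * t + 1) := ⟨t, rfl⟩
    -- With j = r + 1 the sum reaches the last nonzero term for r + 2, while the boundary term
    -- contains the factor r - r.
    have key := sum_oddTerm_sub hodd (2 * t + 2)
    have hz : ∀ k, 2 * t + 1 ≤ k → oddTerm ((2 * t + 1 : ℕ) : ℚ) k = 0 := fun k hk => by
      have : sqProd (((2 * t + 1 : ℕ) : ℚ) ^ 2) k = 0 :=
        prod_eq_zero (mem_range.2 (show 2 * t < k by omega)) (by push_cast; ring)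
      rw [oddTerm, this, zero_div]
    have hB : risingFalling ((2 * t + 1 : ℕ) : ℚ) (2 * t + 2) = 0 := by
      rw [risingFalling, prod_eq_zero (s := range (2 * t + 2))
        (mem_range.2 (show 2 * t + 1 < 2 * t + 2 by omega)) (by push_cast; ring), mul_zero]
    rw [hB] at key
    rw [← mul_sum, sum_sub_distrib, ← mul_sum, ← mul_sum, sum_range_succ _ (2 * t + 2),
      sum_range_succ (fun k => oddTerm ((2 * t + 1 : ℕ) : ℚ) k) (2 * t + 2),
      sum_range_succ (fun k => oddTerm ((2 * t + 1 : ℕ) : ℚ) k) (2 * t + 1),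
      hz _ (by omega), hz _ (by omega)] at key
    have e : ((2 * (t + 1) + 1 : ℕ) : ℚ) = ((2 * t + 1 : ℕ) : ℚ) + 2 := by push_cast; ring
    rw [show 2 * (t + 1) + 1 = 2 * t + 2 + 1 by ring, sum_range_succ _ (2 * t + 2)]
    rw [show ((2 * t + 2 + 1 : ℕ) : ℚ) = ((2 * t + 1 : ℕ) : ℚ) + 2 by push_cast; ring]
    have hr0 : ((2 * t + 1 : ℕ) : ℚ) ≠ 0 := by positivity
    have hr2 : ((2 * t + 1 : ℕ) : ℚ) + 2 ≠ 0 := by positivity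
    generalize ((2 * t + 1 : ℕ) : ℚ) = r at *
    have key2 : (r + 2) / 2 * (3 * (∑ k ∈ range (2 * t + 2), oddTerm (r + 2) k
        + oddTerm (r + 2) (2 * t + 2))) = r / 2 * (2 / r ^ 2) - 2 / (r * (r + 2)) := by
      rw [← ih]
      linear_combination key
    have : 3 * (∑ k ∈ range (2 * t + 2), oddTerm (r + 2) k + oddTerm (r + 2) (2 * t + 2)) =
        2 / (r + 2) * ((r + 2) / 2 * (3 * (∑ k ∈ range (2 * t + 2), oddTerm (r + 2) k
        + oddTerm (r + 2) (2 * t + 2)))) := by field_simp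
    rw [this, key2]
    field_simp
    ring

/-! ### Calculus of p-adic divisibility for rationals -/

/-- `p ^ k` divides `q` in the ring of `p`-integral rational numbers. -/
def PowDvd (p : ℕ) (k : ℤ) (q : ℚ) : Prop := padicNorm p q ≤ (p : ℚ) ^ (-k)

namespace PowDvd

variable {p : ℕ} {k j : ℤ} {a b : ℚ}

lemma neg (h : PowDvd p k a) : PowDvd p k (-a) := by
  simpa only [PowDvd, padicNorm.neg] using h

lemma of_eq (h : PowDvd p k a) (e : b = a) : PowDvd p k b := e ▸ h

variable [hp : Fact p.Prime]

lemma zero : PowDvd p k 0 := by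
  have := hp.out.pos
  simp only [PowDvd, padicNorm.zero]
  positivity

lemma add (h : PowDvd p k a) (h' : PowDvd p k b) : PowDvd p k (a + b) :=
  padicNorm.nonarchimedean.trans (max_le h h')

lemma sub (h : PowDvd p k a) (h' : PowDvd p k b) : PowDvd p k (a - b) :=
  sub_eq_add_neg a b ▸ h.add h'.neg

lemma mul (h : PowDvd p k a) (h' : PowDvd p j b) : PowDvd p (k + j) (a * b) := by
  have hp0 : (p : ℚ) ≠ 0 := by exact_mod_cast hp.out.ne_zero
  rw [PowDvd, padicNorm.mul, neg_add, zpow_add₀ hp0]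
  exact mul_le_mul h h' (padicNorm.nonneg _) (by positivity)

lemma mono (h : PowDvd p k a) (hjk : j ≤ k) : PowDvd p j a :=
  h.trans (zpow_le_zpow_right₀ (by exact_mod_cast hp.out.one_le) (by omega))

lemma sum {ι : Type*} {s : Finset ι} {f : ι → ℚ} (h : ∀ i ∈ s, PowDvd p k (f i)) :
    PowDvd p k (∑ i ∈ s, f i) := by
  classical
  induction s using Finset.induction_on with
  | empty => simpa using zero
  | insert i s hi ih =>
    rw [sum_insert hi]
    exact (h i (mem_insert_self i s)).add (ih fun j hj => h j (mem_insert_of_mem hj))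

lemma mul_int (h : PowDvd p k a) (h' : PowDvd p 0 b) : PowDvd p k (a * b) := by
  simpa using h.mul h'

lemma int_mul (h : PowDvd p 0 a) (h' : PowDvd p k b) : PowDvd p k (a * b) := by
  simpa using h.mul h'

lemma intCast (n : ℤ) : PowDvd p 0 (n : ℚ) := by
  simpa [PowDvd] using padicNorm.of_int n

lemma natCast (n : ℕ) : PowDvd p 0 (n : ℚ) := intCast n

lemma one : PowDvd p 0 (1 : ℚ) := by simpa using natCast (p := p) 1

lemma pow (h : PowDvd p 0 a) (n : ℕ) : PowDvd p 0 (a ^ n) := by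
  induction n with
  | zero => simpa using one
  | succ n ih => rw [pow_succ]; exact ih.mul_int h

lemma self_zpow (k : ℤ) : PowDvd p k ((p : ℚ) ^ k) := by
  have h : padicNorm p ((p : ℚ) ^ k) = (p : ℚ) ^ (-k) := by
    have h1 : (p : ℚ) ^ k ≠ 0 := zpow_ne_zero _ (by exact_mod_cast hp.out.ne_zero)
    rw [padicNorm.eq_zpow_of_nonzero h1]
    simp
  exact h.le

lemma self_pow (n : ℕ) : PowDvd p n ((p : ℚ) ^ n) := by
  simpa using self_zpow (p := p) n

lemma inv_intCast {n : ℤ} (h : ¬ (p : ℤ) ∣ n) : PowDvd p 0 ((n : ℚ)⁻¹) := by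
  rw [PowDvd, ← one_div, padicNorm.div, (padicNorm.int_eq_one_iff n).2 h]
  simp

lemma inv_natCast {n : ℕ} (h : ¬ p ∣ n) : PowDvd p 0 ((n : ℚ)⁻¹) := by
  simpa using inv_intCast (p := p) (n := n) (by exact_mod_cast h)

lemma of_natCast_mul {n : ℕ} (hn : ¬ p ∣ n) (h : PowDvd p k (n * a)) : PowDvd p k a := by
  have h0 : (n : ℚ) ≠ 0 := by
    rintro h0
    exact hn (by rw [Nat.cast_eq_zero.1 h0]; exact dvd_zero p)
  have := (inv_natCast hn).int_mul h
  rwa [inv_mul_cancel_left₀ h0] at this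

lemma pow_mul {n : ℕ} (h : PowDvd p 0 a) : PowDvd p n ((p : ℚ) ^ n * a) :=
  (self_pow n).mul_int h

lemma of_eq_intCast (n : ℤ) (h : a = n) : PowDvd p 0 a := h ▸ intCast n

lemma of_eq_pow_mul (n : ℕ) (h : PowDvd p 0 b) (e : a = (p : ℚ) ^ n * b) : PowDvd p n a :=
  e ▸ pow_mul h

lemma pow_mul' {n : ℕ} (h : PowDvd p k a) : PowDvd p (n + k) ((p : ℚ) ^ n * a) :=
  (self_pow n).mul h

lemma of_pow_mul {n : ℕ} (h : PowDvd p k ((p : ℚ) ^ n * a)) : PowDvd p (k - n) a := by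
  have hp0 : (p : ℚ) ≠ 0 := by exact_mod_cast hp.out.ne_zero
  have h1 := (self_zpow (p := p) (-n)).mul h
  rw [← mul_assoc, ← zpow_natCast, ← zpow_add₀ hp0] at h1
  simp only [neg_add_cancel, zpow_zero, one_mul] at h1
  exact h1.mono (by omega)

/-- Since 2n < p², p divides C(2n,n) at most once. Inverse central binomials therefore cost one
power of p in every later estimate. -/
lemma inv_centralBinom {n : ℕ} (h : n < p) :
    PowDvd p (-1) ((n.centralBinom : ℚ)⁻¹) := by
  have h0 : (n.centralBinom : ℚ) ≠ 0 := by exact_mod_cast Nat.centralBinom_ne_zero n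
  have h1 : (n.centralBinom).factorization p ≤ 1 :=
    Nat.factorization_choose_le_one (by have := hp.out.two_le; nlinarith)
  rw [PowDvd, padicNorm.eq_zpow_of_nonzero (inv_ne_zero h0)]
  refine zpow_le_zpow_right₀ (by exact_mod_cast hp.out.one_le) ?_
  rw [padicValRat.inv, padicValRat.of_nat, ← Nat.factorization_def _ hp.out]
  omega

lemma ratModEq (h : PowDvd p 1 (a - b)) : RatModEq p a b := by
  have hp0 : (p : ℚ) ≠ 0 := by exact_mod_cast hp.out.ne_zero
  refine ⟨(a - b) / p, ?_, by field_simp⟩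
  have h1 : PowDvd p 0 ((a - b) / p) := by
    have := of_pow_mul (p := p) (n := 1) (k := 1) (a := (a - b) / p)
      (by rwa [pow_one, mul_div_cancel₀ _ hp0])
    simpa using this
  rw [Nat.coprime_comm, Nat.Prime.coprime_iff_not_dvd hp.out]
  intro hd
  set c := (a - b) / p
  have hnum : ¬ (p : ℤ) ∣ c.num := fun hn => by
    have := Nat.dvd_gcd (Int.natCast_dvd.1 hn) hd
    rw [c.reduced.gcd_eq_one] at this
    exact hp.out.one_lt.ne' (Nat.dvd_one.1 this)
  have h2 : padicNorm p c * padicNorm p c.den = padicNorm p c.num := by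
    rw [← padicNorm.mul]
    congr 1
    exact_mod_cast Rat.mul_den_eq_num c
  rw [(padicNorm.int_eq_one_iff _).2 hnum] at h2
  have h3 := (padicNorm.nat_lt_one_iff (p := p) c.den).2 hd
  have h4 : padicNorm p c ≤ 1 := by simpa [PowDvd] using h1
  have := padicNorm.nonneg (p := p) c
  have := padicNorm.nonneg (p := p) c.den
  nlinarith

/-- Expansion in p²: the p⁴ coefficient is ∑ d plus the second elementary symmetric function of the
b. -/
lemma prod_sub_second_order {f b d : ℕ → ℚ} (n : ℕ) (hb : ∀ m < n, PowDvd p 0 (b m))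
    (hd : ∀ m < n, PowDvd p 0 (d m))
    (h : ∀ m < n, PowDvd p 6 (f m - (1 + p ^ 2 * b m + p ^ 4 * d m))) :
    PowDvd p 6 (∏ m ∈ range n, f m - (1 + p ^ 2 * ∑ m ∈ range n, b m
      + p ^ 4 * ∑ m ∈ range n, (d m + b m * ∑ i ∈ range m, b i))) := by
  induction n with
  | zero => simpa using zero
  | succ n ih =>
    have ih := ih (fun m hm => hb m (by omega)) (fun m hm => hd m (by omega))
      fun m hm => h m (by omega)
    have hB : PowDvd p 0 (∑ m ∈ range n, b m) :=
      sum fun m hm => hb m ((mem_range.1 hm).trans n.lt_succ_self)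
    have hE : PowDvd p 0 (∑ m ∈ range n, (d m + b m * ∑ i ∈ range m, b i)) :=
      sum fun m hm => by
        have hm := mem_range.1 hm
        exact (hd m (by omega)).add ((hb m (by omega)).mul_int
          (sum fun i hi => hb i (by have := mem_range.1 hi; omega)))
    rw [prod_range_succ, sum_range_succ, sum_range_succ]
    set P := ∏ m ∈ range n, f m
    set B := ∑ m ∈ range n, b m
    set E := ∑ m ∈ range n, (d m + b m * ∑ i ∈ range m, b i)
    have hbn := hb n (by omega)
    have hdn := hd n (by omega)
    have hfn := h n (by omega)
    have hp2 : PowDvd p 0 ((p : ℚ) ^ 2) := (natCast p).pow 2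
    have hp4 : PowDvd p 0 ((p : ℚ) ^ 4) := (natCast p).pow 4
    have hP : PowDvd p 0 (1 + p ^ 2 * B + p ^ 4 * E) :=
      (one.add (hp2.mul_int hB)).add (hp4.mul_int hE)
    have hF : PowDvd p 0 (f n) := by
      have := (hfn.mono (show (0 : ℤ) ≤ 6 by norm_num)).add
        ((one.add (hp2.mul_int hbn)).add (hp4.mul_int hdn))
      rwa [sub_add_cancel] at this
    have key : P * f n - (1 + p ^ 2 * (B + b n) + p ^ 4 * (E + (d n + b n * B))) =
        (P - (1 + p ^ 2 * B + p ^ 4 * E)) * f n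
        + (1 + p ^ 2 * B + p ^ 4 * E) * (f n - (1 + p ^ 2 * b n + p ^ 4 * d n))
        + p ^ 6 * (B * d n + E * b n + p ^ 2 * (E * d n)) := by ring
    rw [key]
    exact ((ih.mul_int hF).add (hP.int_mul hfn)).add
      (pow_mul (((hB.mul_int hdn).add (hE.mul_int hbn)).add (hp2.mul_int (hE.mul_int hdn))))

lemma prod_sub_first_order {f b : ℕ → ℚ} (n : ℕ) (hb : ∀ m < n, PowDvd p 0 (b m))
    (h : ∀ m < n, PowDvd p 4 (f m - (1 + p ^ 2 * b m))) :
    PowDvd p 4 (∏ m ∈ range n, f m - (1 + p ^ 2 * ∑ m ∈ range n, b m)) := by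
  induction n with
  | zero => simpa using zero
  | succ n ih =>
    have ih := ih (fun m hm => hb m (by omega)) fun m hm => h m (by omega)
    have hB : PowDvd p 0 (∑ m ∈ range n, b m) :=
      sum fun m hm => hb m ((mem_range.1 hm).trans n.lt_succ_self)
    rw [prod_range_succ, sum_range_succ]
    set P := ∏ m ∈ range n, f m
    set B := ∑ m ∈ range n, b m
    have hbn := hb n (by omega)
    have hfn := h n (by omega)
    have hp2 : PowDvd p 0 ((p : ℚ) ^ 2) := (natCast p).pow 2
    have hP : PowDvd p 0 (1 + p ^ 2 * B) := one.add (hp2.mul_int hB)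
    have hF : PowDvd p 0 (f n) := by
      have := (hfn.mono (show (0 : ℤ) ≤ 4 by norm_num)).add (one.add (hp2.mul_int hbn))
      rwa [sub_add_cancel] at this
    have key : P * f n - (1 + p ^ 2 * (B + b n)) =
        (P - (1 + p ^ 2 * B)) * f n + (1 + p ^ 2 * B) * (f n - (1 + p ^ 2 * b n))
        + p ^ 4 * (B * b n) := by ring
    rw [key]
    exact ((ih.mul_int hF).add (hP.int_mul hfn)).add (pow_mul (hB.mul_int hbn))

end PowDvd

/-! ### Power sums modulo powers of p -/

lemma two_mul_sum_mul_sum_range (b : ℕ → ℚ) (n : ℕ) :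
    2 * ∑ m ∈ range n, b m * ∑ i ∈ range m, b i
      = (∑ m ∈ range n, b m) ^ 2 - ∑ m ∈ range n, b m ^ 2 := by
  induction n with
  | zero => simp
  | succ n ih =>
    rw [sum_range_succ, sum_range_succ, sum_range_succ, mul_add, ih]
    ring

/-- The power sum `∑_{k=1}^{p-1} 1 / k^s`. -/
def hsum (p s : ℕ) : ℚ := ∑ k ∈ range (p - 1), 1 / ((k : ℚ) + 1) ^ s

lemma cast_sub_succ {p k : ℕ} (hk : k < p - 1) :
    (((p - 1 - 1 - k : ℕ) : ℚ) + 1) = (p : ℚ) - (k + 1) := by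
  have : (p - 1 - 1 - k) + 1 + (k + 1) = p := by omega
  rw [eq_sub_iff_add_eq]
  exact_mod_cast this

lemma sub_succ_ne_zero {p k : ℕ} (hk : k < p - 1) : (p : ℚ) - (k + 1) ≠ 0 := by
  rw [← cast_sub_succ hk]
  positivity

lemma sum_range_reflect_pred (p : ℕ) (f : ℚ → ℚ) :
    ∑ k ∈ range (p - 1), f ((p : ℚ) - (k + 1)) = ∑ k ∈ range (p - 1), f ((k : ℚ) + 1) := by
  rw [← sum_range_reflect]
  refine sum_congr rfl fun k hk => ?_
  rw [cast_sub_succ (mem_range.1 hk)]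
  congr 1
  ring

section
variable {p : ℕ} [hp : Fact p.Prime]

lemma powDvd_inv_succ {k : ℕ} (hk : k < p - 1) : PowDvd p 0 ((k : ℚ) + 1)⁻¹ := by
  have := PowDvd.inv_natCast (p := p) (n := k + 1)
    (Nat.not_dvd_of_pos_of_lt k.succ_pos (by omega))
  exact_mod_cast this

lemma powDvd_one_div_succ_pow {k : ℕ} (hk : k < p - 1) (s : ℕ) :
    PowDvd p 0 (1 / ((k : ℚ) + 1) ^ s) := by
  rw [one_div, ← inv_pow]
  exact (powDvd_inv_succ hk).pow s

lemma powDvd_inv_sub_succ {k : ℕ} (hk : k < p - 1) : PowDvd p 0 ((p : ℚ) - (k + 1))⁻¹ := by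
  rw [← cast_sub_succ hk]
  exact powDvd_inv_succ (by omega)

lemma powDvd_inv_add_succ {k : ℕ} (hk : k < p - 1) : PowDvd p 0 ((p : ℚ) + (k + 1))⁻¹ := by
  have := PowDvd.inv_natCast (p := p) (n := p + (k + 1)) fun h =>
    Nat.not_dvd_of_pos_of_lt k.succ_pos (by omega) ((Nat.dvd_add_right dvd_rfl).1 h)
  exact_mod_cast this

lemma powDvd_hsum (s : ℕ) : PowDvd p 0 (hsum p s) :=
  PowDvd.sum fun _ hk => powDvd_one_div_succ_pow (mem_range.1 hk) s

end

section
variable {p : ℕ} [hp : Fact p.Prime]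

lemma powDvd_one_div_add_sq {j : ℕ} (hj : j < p - 1) :
    PowDvd p 3 (1 / ((p : ℚ) + (j + 1)) ^ 2 - (1 / ((j : ℚ) + 1) ^ 2
      - 2 * p * (1 / ((j : ℚ) + 1) ^ 3) + 3 * p ^ 2 * (1 / ((j : ℚ) + 1) ^ 4))) := by
  have hn : PowDvd p 0 (-(4 * ((j : ℚ) + 1) + 3 * p)) :=
    .of_eq_intCast (-(4 * ((j : ℤ) + 1) + 3 * p)) (by push_cast; ring)
  have h1 : (p : ℚ) + (j + 1) ≠ 0 := by positivity
  exact .of_eq_pow_mul 3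
    ((hn.mul_int ((powDvd_inv_succ hj).pow 4)).mul_int ((powDvd_inv_add_succ hj).pow 2))
    (by field_simp; ring)

lemma powDvd_one_div_sub_sq {j : ℕ} (hj : j < p - 1) :
    PowDvd p 3 (1 / ((p : ℚ) - (j + 1)) ^ 2 - (1 / ((j : ℚ) + 1) ^ 2
      + 2 * p * (1 / ((j : ℚ) + 1) ^ 3) + 3 * p ^ 2 * (1 / ((j : ℚ) + 1) ^ 4))) := by
  have hn : PowDvd p 0 (4 * ((j : ℚ) + 1) - 3 * p) :=
    .of_eq_intCast (4 * ((j : ℤ) + 1) - 3 * p) (by push_cast; ring)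
  have h1 := sub_succ_ne_zero hj
  exact .of_eq_pow_mul 3
    ((hn.mul_int ((powDvd_inv_succ hj).pow 4)).mul_int ((powDvd_inv_sub_succ hj).pow 2))
    (by field_simp; ring)

lemma powDvd_one_div_add_pow_four {j : ℕ} (hj : j < p - 1) :
    PowDvd p 1 (1 / ((p : ℚ) + (j + 1)) ^ 4 - 1 / ((j : ℚ) + 1) ^ 4) := by
  have hn : PowDvd p 0 (-(4 * ((j : ℚ) + 1) ^ 3 + 6 * p * (j + 1) ^ 2 + 4 * p ^ 2 * (j + 1)
      + p ^ 3)) :=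
    .of_eq_intCast (-(4 * ((j : ℤ) + 1) ^ 3 + 6 * p * (j + 1) ^ 2
      + 4 * p ^ 2 * (j + 1) + p ^ 3)) (by push_cast; ring)
  have h1 : (p : ℚ) + (j + 1) ≠ 0 := by positivity
  exact .of_eq_pow_mul 1
    ((hn.mul_int ((powDvd_inv_succ hj).pow 4)).mul_int ((powDvd_inv_add_succ hj).pow 4))
    (by field_simp; ring)

lemma powDvd_one_div_sub_pow_four {j : ℕ} (hj : j < p - 1) :
    PowDvd p 1 (1 / ((p : ℚ) - (j + 1)) ^ 4 - 1 / ((j : ℚ) + 1) ^ 4) := by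
  have hn : PowDvd p 0 (4 * ((j : ℚ) + 1) ^ 3 - 6 * p * (j + 1) ^ 2 + 4 * p ^ 2 * (j + 1)
      - p ^ 3) :=
    .of_eq_intCast (4 * ((j : ℤ) + 1) ^ 3 - 6 * p * (j + 1) ^ 2
      + 4 * p ^ 2 * (j + 1) - p ^ 3) (by push_cast; ring)
  have h1 := sub_succ_ne_zero hj
  exact .of_eq_pow_mul 1
    ((hn.mul_int ((powDvd_inv_succ hj).pow 4)).mul_int ((powDvd_inv_sub_succ hj).pow 4))
    (by field_simp; ring)

lemma powDvd_one_div_sub_cube {j : ℕ} (hj : j < p - 1) :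
    PowDvd p 2 (1 / ((p : ℚ) - (j + 1)) ^ 3 + 1 / ((j : ℚ) + 1) ^ 3
      + 3 * p * (1 / ((j : ℚ) + 1) ^ 4)) := by
  have hn : PowDvd p 0 (6 * ((j : ℚ) + 1) ^ 2 - 8 * p * (j + 1) + 3 * p ^ 2) :=
    .of_eq_intCast (6 * ((j : ℤ) + 1) ^ 2 - 8 * p * (j + 1) + 3 * p ^ 2) (by push_cast; ring)
  have h1 := sub_succ_ne_zero hj
  exact .of_eq_pow_mul 2
    ((hn.mul_int ((powDvd_inv_succ hj).pow 4)).mul_int ((powDvd_inv_sub_succ hj).pow 3))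
    (by field_simp; ring)

lemma powDvd_one_div_sub {j : ℕ} (hj : j < p - 1) :
    PowDvd p 4 (1 / ((p : ℚ) - (j + 1)) + 1 / ((j : ℚ) + 1) + p * (1 / ((j : ℚ) + 1) ^ 2)
      + p ^ 2 * (1 / ((j : ℚ) + 1) ^ 3) + p ^ 3 * (1 / ((j : ℚ) + 1) ^ 4)) := by
  have h1 := sub_succ_ne_zero hj
  exact .of_eq_pow_mul 4
    (((powDvd_inv_succ hj).pow 4).mul_int (powDvd_inv_sub_succ hj))
    (by field_simp; ring)

end

/-- The sum of `1 / k^s` over the odd `k < 2t`. -/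
def oddSum (t s : ℕ) : ℚ := ∑ k ∈ range t, 1 / (((2 * k : ℕ) : ℚ) + 1) ^ s

lemma sum_range_two_mul (f : ℚ → ℚ) (t : ℕ) :
    ∑ k ∈ range (2 * t), f ((k : ℚ) + 1) =
      ∑ k ∈ range t, f (((2 * k : ℕ) : ℚ) + 1) + ∑ k ∈ range t, f (2 * ((k : ℚ) + 1)) := by
  induction t with
  | zero => simp
  | succ t ih =>
    rw [show 2 * (t + 1) = 2 * t + 1 + 1 by ring, sum_range_succ, sum_range_succ, ih,
      sum_range_succ _ t, sum_range_succ _ t]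
    have : ((2 * t + 1 : ℕ) : ℚ) + 1 = 2 * (t + 1) := by push_cast; ring
    rw [this]
    ring

lemma sum_range_two_mul_alternating (f : ℚ → ℚ) (t : ℕ) :
    ∑ k ∈ range (2 * t), (-1) ^ k * f ((k : ℚ) + 1) =
      ∑ k ∈ range t, f (((2 * k : ℕ) : ℚ) + 1) - ∑ k ∈ range t, f (2 * ((k : ℚ) + 1)) := by
  induction t with
  | zero => simp
  | succ t ih =>
    rw [show 2 * (t + 1) = 2 * t + 1 + 1 by ring, sum_range_succ, sum_range_succ, ih,
      sum_range_succ _ t, sum_range_succ _ t]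
    have : ((2 * t + 1 : ℕ) : ℚ) + 1 = 2 * (t + 1) := by push_cast; ring
    rw [this, pow_succ, pow_mul]
    norm_num
    ring

lemma sum_even_reflect (f : ℚ → ℚ) (t : ℕ) :
    ∑ k ∈ range t, f (2 * ((k : ℚ) + 1)) =
      ∑ k ∈ range t, f (((2 * t + 1 : ℕ) : ℚ) - (((2 * k : ℕ) : ℚ) + 1)) := by
  rw [← sum_range_reflect]
  refine sum_congr rfl fun k hk => ?_
  congr 1
  have h := mem_range.1 hk
  obtain ⟨d, rfl⟩ : ∃ d, t = k + 1 + d := ⟨t - (k + 1), by omega⟩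
  rw [show k + 1 + d - 1 - k = d by omega]
  push_cast
  ring

lemma sum_double (f : ℚ → ℚ) (t : ℕ) :
    ∑ k ∈ range (2 * t), f (2 * ((k : ℚ) + 1)) =
      ∑ k ∈ range t, f (2 * ((k : ℚ) + 1))
        + ∑ k ∈ range t, f (((2 * t + 1 : ℕ) : ℚ) + (((2 * k : ℕ) : ℚ) + 1)) := by
  rw [two_mul, sum_range_add]
  congr 1
  refine sum_congr rfl fun k _ => ?_
  congr 1
  push_cast
  ring

section
variable {p : ℕ} [hp : Fact p.Prime]

lemma powDvd_sum_of_forall {n : ℕ} {k : ℤ} {f : ℕ → ℚ} (h : ∀ i < n, PowDvd p k (f i)) :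
    PowDvd p k (∑ i ∈ range n, f i) :=
  PowDvd.sum fun i hi => h i (mem_range.1 hi)

lemma not_dvd_of_prime_lt {q : ℕ} (hq : q.Prime) (h : q < p) : ¬ p ∣ q := fun hd =>
  absurd ((Nat.prime_dvd_prime_iff_eq hp.out hq).1 hd) h.ne'

lemma powDvd_oddSum {t : ℕ} (ht : p = 2 * t + 1) (s : ℕ) : PowDvd p 0 (oddSum t s) :=
  powDvd_sum_of_forall fun _ hk => powDvd_one_div_succ_pow (by omega) s

/-- Doubling 1, …, p-1 gives the even numbers below p and p plus the odd ones, so 2⁻⁴ H_4 ≡ H_4 mod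
p. The reflection k ↦ p - k equates the even and odd parts. -/
lemma powDvd_power_four {t : ℕ} (ht : p = 2 * t + 1) (h5 : 5 < p) :
    PowDvd p 1 (hsum p 4) ∧ PowDvd p 1 (oddSum t 4) ∧
      PowDvd p 1 (∑ k ∈ range (p - 1), (-1) ^ k * (1 / ((k : ℚ) + 1) ^ 4)) := by
  have hpt : p - 1 = 2 * t := by omega
  have hE := powDvd_sum_of_forall (n := t) (p := p) fun k hk =>
    powDvd_one_div_sub_pow_four (p := p) (j := 2 * k) (by omega)
  have hO := powDvd_sum_of_forall (n := t) (p := p) fun k hk =>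
    powDvd_one_div_add_pow_four (p := p) (j := 2 * k) (by omega)
  rw [sum_sub_distrib] at hE hO
  have e1 := sum_range_two_mul (fun x => 1 / x ^ 4) t
  have e2 := sum_range_two_mul_alternating (fun x => 1 / x ^ 4) t
  have e3 := sum_even_reflect (fun x => 1 / x ^ 4) t
  have e4 := sum_double (fun x => 1 / x ^ 4) t
  have e5 : ∑ k ∈ range (2 * t), 1 / (2 * ((k : ℚ) + 1)) ^ 4 = 1 / 16 * hsum p 4 := by
    rw [hsum, hpt, mul_sum]
    refine sum_congr rfl fun k _ => ?_
    field_simp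
    norm_num
  simp only [← ht] at e1 e2 e3 e4
  rw [e5] at e4
  have e6 : hsum p 4 = ∑ k ∈ range (2 * t), 1 / ((k : ℚ) + 1) ^ 4 := by rw [hsum, hpt]
  rw [← e6] at e1
  rw [hpt, e2]
  rw [← e3] at hE
  change PowDvd p 1 (_ - oddSum t 4) at hE hO
  change _ = oddSum t 4 + _ at e1
  change _ = _ + _ at e4
  change _ ∧ _ ∧ PowDvd p 1 (oddSum t 4 - _)
  generalize ∑ k ∈ range t, 1 / ((p : ℚ) + (((2 * k : ℕ) : ℚ) + 1)) ^ 4 = X at *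
  generalize ∑ k ∈ range t, 1 / (2 * ((k : ℚ) + 1)) ^ 4 = E at *
  have h4 : PowDvd p 1 (hsum p 4) := by
    -- The factor 15 = 2⁴ - 1 must be cancelled, which requires p ≠ 3, 5.
    refine PowDvd.of_natCast_mul (n := 3) (not_dvd_of_prime_lt Nat.prime_three (by omega)) ?_
    refine PowDvd.of_natCast_mul (n := 5) (not_dvd_of_prime_lt Nat.prime_five (by omega)) ?_
    have := ((PowDvd.natCast (p := p) 16).int_mul hO).neg
    convert this using 1
    push_cast
    linear_combination (-16) * e4 + 16 * e1
  refine ⟨h4, ?_, ?_⟩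
  · refine PowDvd.of_natCast_mul (n := 2) (not_dvd_of_prime_lt Nat.prime_two (by omega)) ?_
    convert h4.sub hE using 1
    push_cast
    linear_combination -e1
  · convert hE.neg using 1
    ring

/-- Expanding 1/(p-k)³ and summing gives 2H_3 + 3pH_4 ≡ 0 mod p². -/
lemma powDvd_hsum_three (h5 : 5 < p) : PowDvd p 2 (hsum p 3) := by
  obtain ⟨t, ht⟩ := hp.out.odd_of_ne_two (by omega)
  have h4 := (powDvd_power_four ht h5).1
  have h := powDvd_sum_of_forall (n := p - 1) (p := p) fun k hk =>
    powDvd_one_div_sub_cube (p := p) (j := k) hk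
  rw [sum_add_distrib, sum_add_distrib, sum_range_reflect_pred p (fun x => 1 / x ^ 3),
    ← mul_sum] at h
  change PowDvd p 2 (hsum p 3 + hsum p 3 + 3 * p * hsum p 4) at h
  have h' := (PowDvd.pow_mul' (n := 1) h4).mul_int (PowDvd.natCast 3)
  refine PowDvd.of_natCast_mul (n := 2) (not_dvd_of_prime_lt Nat.prime_two (by omega)) ?_
  convert h.sub h' using 1
  push_cast
  ring

/-- Expanding 1/(p-k) to order p⁴ also produces p²H_3 and p³H_4, both of which vanish mod p⁴. -/
lemma powDvd_hsum_one_add (h5 : 5 < p) : PowDvd p 4 (2 * hsum p 1 + p * hsum p 2) := by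
  obtain ⟨t, ht⟩ := hp.out.odd_of_ne_two (by omega)
  have h4 := PowDvd.pow_mul' (n := 3) (powDvd_power_four ht h5).1
  have h3 := PowDvd.pow_mul' (n := 2) (powDvd_hsum_three h5)
  have h := powDvd_sum_of_forall (n := p - 1) (p := p) fun k hk =>
    powDvd_one_div_sub (p := p) (j := k) hk
  rw [sum_add_distrib, sum_add_distrib, sum_add_distrib, sum_add_distrib,
    sum_range_reflect_pred p (fun x => 1 / x), ← mul_sum, ← mul_sum, ← mul_sum] at h
  have e : ∑ k ∈ range (p - 1), 1 / ((k : ℚ) + 1) = hsum p 1 := by simp [hsum]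
  rw [e] at h
  change PowDvd p 4 (hsum p 1 + hsum p 1 + p * hsum p 2 + p ^ 2 * hsum p 3 + p ^ 3 * hsum p 4) at h
  convert (h.sub h3).sub h4 using 1
  ring

/-- Let O_3 be the sum of 1/k³ over odd k < p. Doubling gives 3H_2 ≡ 8pO_3 and reflection gives A ≡
-2pO_3, both mod p³; eliminating O_3 gives the second claim. -/
lemma powDvd_power_two (h5 : 5 < p) :
    PowDvd p 1 (hsum p 2) ∧
      PowDvd p 3 (4 * ∑ k ∈ range (p - 1), (-1) ^ k * (1 / ((k : ℚ) + 1) ^ 2)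
        + 3 * hsum p 2) := by
  obtain ⟨t, ht⟩ := hp.out.odd_of_ne_two (by omega)
  have hpt : p - 1 = 2 * t := by omega
  have hE := powDvd_sum_of_forall (n := t) (p := p) fun k hk =>
    powDvd_one_div_sub_sq (p := p) (j := 2 * k) (by omega)
  have hO := powDvd_sum_of_forall (n := t) (p := p) fun k hk =>
    powDvd_one_div_add_sq (p := p) (j := 2 * k) (by omega)
  rw [sum_sub_distrib, sum_add_distrib, sum_add_distrib, ← mul_sum, ← mul_sum] at hE
  rw [sum_sub_distrib, sum_add_distrib, sum_sub_distrib, ← mul_sum, ← mul_sum] at hO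
  have e1 := sum_range_two_mul (fun x => 1 / x ^ 2) t
  have e2 := sum_range_two_mul_alternating (fun x => 1 / x ^ 2) t
  have e3 := sum_even_reflect (fun x => 1 / x ^ 2) t
  have e4 := sum_double (fun x => 1 / x ^ 2) t
  have e5 : ∑ k ∈ range (2 * t), 1 / (2 * ((k : ℚ) + 1)) ^ 2 = 1 / 4 * hsum p 2 := by
    rw [hsum, hpt, mul_sum]
    refine sum_congr rfl fun k _ => ?_
    field_simp
    norm_num
  simp only [← ht] at e1 e2 e3 e4
  rw [e5] at e4
  have e6 : hsum p 2 = ∑ k ∈ range (2 * t), 1 / ((k : ℚ) + 1) ^ 2 := by rw [hsum, hpt]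
  rw [← e6] at e1
  rw [hpt, e2]
  rw [← e3] at hE
  change PowDvd p 3 (_ - (oddSum t 2 + 2 * p * oddSum t 3 + 3 * p ^ 2 * oddSum t 4)) at hE
  change PowDvd p 3 (_ - (oddSum t 2 - 2 * p * oddSum t 3 + 3 * p ^ 2 * oddSum t 4)) at hO
  change _ = oddSum t 2 + _ at e1
  change _ ∧ PowDvd p 3 (4 * (oddSum t 2 - _) + _)
  have h4 := PowDvd.pow_mul' (n := 2) (powDvd_power_four ht h5).2.1
  have h3 := PowDvd.pow_mul (n := 1) (powDvd_oddSum ht 3)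
  generalize ∑ k ∈ range t, 1 / ((p : ℚ) + (((2 * k : ℕ) : ℚ) + 1)) ^ 2 = X at *
  generalize ∑ k ∈ range t, 1 / (2 * ((k : ℚ) + 1)) ^ 2 = E at *
  have key : PowDvd p 3 (3 * hsum p 2 - 8 * p * oddSum t 3) := by
    have := ((PowDvd.natCast (p := p) 4).int_mul hO).add ((PowDvd.natCast (p := p) 12).int_mul h4)
    convert this.neg using 1
    push_cast
    linear_combination (-4) * e4 + 4 * e1
  constructor
  · refine PowDvd.of_natCast_mul (n := 3) (not_dvd_of_prime_lt Nat.prime_three (by omega)) ?_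
    convert (key.mono (by norm_num)).add ((PowDvd.natCast (p := p) 8).int_mul h3) using 1
    push_cast
    ring
  · have := ((PowDvd.natCast (p := p) 4).int_mul hE).add ((PowDvd.natCast (p := p) 12).int_mul h4)
    convert key.sub this using 1
    push_cast
    ring

/-- The partial sum `∑_{m=1}^{k} 1 / m²`. -/
def sqSum (k : ℕ) : ℚ := ∑ m ∈ range k, 1 / ((m : ℚ) + 1) ^ 2

lemma powDvd_sqSum {k : ℕ} (hk : k ≤ p - 1) : PowDvd p 0 (sqSum k) :=
  powDvd_sum_of_forall fun _ hm => powDvd_one_div_succ_pow (by omega) 2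

lemma powDvd_sum_mul_sqSum (h5 : 5 < p) :
    PowDvd p 1 (∑ k ∈ range (p - 1), 1 / ((k : ℚ) + 1) ^ 2 * sqSum k) := by
  obtain ⟨t, ht⟩ := hp.out.odd_of_ne_two (by omega)
  have h := two_mul_sum_mul_sum_range (fun m => 1 / ((m : ℚ) + 1) ^ 2) (p - 1)
  have h4 : ∑ m ∈ range (p - 1), (1 / ((m : ℚ) + 1) ^ 2) ^ 2 = hsum p 4 := by
    refine sum_congr rfl fun m _ => ?_
    field_simp
  rw [h4] at h
  change 2 * ∑ m ∈ range (p - 1), 1 / ((m : ℚ) + 1) ^ 2 * sqSum m = hsum p 2 ^ 2 - hsum p 4 at h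
  refine PowDvd.of_natCast_mul (n := 2) (not_dvd_of_prime_lt Nat.prime_two (by omega)) ?_
  push_cast
  rw [h, sq]
  exact ((powDvd_power_two h5).1.mul_int (powDvd_hsum 2)).sub (powDvd_power_four ht h5).1

end

/-! ### p-adic expansion of the products at x = p² and x = p²/4 -/

lemma sqProd_div_factorial_sq (x : ℚ) (k : ℕ) :
    sqProd x k / (k.factorial : ℚ) ^ 2 = ∏ m ∈ range k, (1 - x / ((m : ℚ) + 1) ^ 2) := by
  induction k with
  | zero => simp [sqProd]
  | succ k ih =>
    rw [prod_range_succ, ← ih, sqProd_succ, Nat.factorial_succ]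
    have : (k.factorial : ℚ) ≠ 0 := by positivity
    push_cast
    field_simp

lemma sqProd_zero_left (k : ℕ) : sqProd 0 k = (k.factorial : ℚ) ^ 2 := by
  induction k with
  | zero => simp [sqProd]
  | succ k ih =>
    rw [sqProd_succ, ih, Nat.factorial_succ]
    push_cast
    ring

lemma sqProd_div_sqProd (x y : ℚ) (k : ℕ) :
    sqProd x k / sqProd y k =
      ∏ m ∈ range k, ((((m : ℚ) + 1) ^ 2 - x) / (((m : ℚ) + 1) ^ 2 - y)) :=
  (prod_div_distrib _ _).symm

/-- (p+k)!/(p-1-k)! is the product of p + m over -k ≤ m ≤ k; pair m with -m. -/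
lemma cast_factorial_add {p k : ℕ} (hk : k < p) :
    ((p + k).factorial : ℚ) =
      p * (p - 1 - k).factorial * ((-1) ^ k * sqProd ((p : ℚ) ^ 2) k) := by
  induction k with
  | zero =>
    obtain ⟨q, rfl⟩ : ∃ q, p = q + 1 := ⟨p - 1, by omega⟩
    simp [sqProd, Nat.factorial_succ]
  | succ k ih =>
    obtain ⟨d, rfl⟩ : ∃ d, p = k + 1 + 1 + d := ⟨p - (k + 1 + 1), by omega⟩
    have ih := ih (by omega)
    rw [show k + 1 + 1 + d - 1 - k = d + 1 by omega, Nat.factorial_succ d] at ih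
    rw [show k + 1 + 1 + d - 1 - (k + 1) = d by omega, ← add_assoc, Nat.factorial_succ,
      Nat.cast_mul, ih, sqProd_succ]
    push_cast
    ring

lemma cast_centralBinom_eq {p : ℕ} (hp : Odd p) :
    (p.centralBinom : ℚ) =
      2 * (sqProd ((p : ℚ) ^ 2) (p - 1) / ((p - 1).factorial : ℚ) ^ 2) := by
  obtain ⟨q, rfl⟩ : ∃ q, p = q + 1 := ⟨p - 1, by have := hp.pos; omega⟩
  have hq : Even q := by
    rw [Nat.odd_add_one] at hp
    simpa using hp
  have h := cast_factorial_add (p := q + 1) (k := q) (by omega)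
  have h2 := Nat.choose_mul_factorial_mul_factorial (show q + 1 ≤ 2 * (q + 1) by omega)
  rw [show 2 * (q + 1) - (q + 1) = q + 1 by omega, ← Nat.centralBinom_eq_two_mul_choose,
    show 2 * (q + 1) = (q + 1 + q) + 1 by ring, Nat.factorial_succ (q + 1 + q)] at h2
  have h3 : ((q + 1).centralBinom : ℚ) * (q + 1).factorial * (q + 1).factorial =
    (q + 1 + q + 1 : ℕ) * (q + 1 + q).factorial := by exact_mod_cast h2
  rw [h, Nat.factorial_succ q, hq.neg_one_pow] at h3
  simp only [show q + 1 - 1 = q by omega, Nat.sub_self, Nat.factorial_zero] at h3 ⊢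
  have hf : (q.factorial : ℚ) ≠ 0 := by positivity
  have hq1 : (q : ℚ) + 1 ≠ 0 := by positivity
  rw [← mul_div_assoc, eq_div_iff (by positivity)]
  refine mul_left_cancel₀ (pow_ne_zero 2 hq1) ?_
  push_cast at h3 ⊢
  linear_combination h3

lemma sq_sub_sq_ne_zero {p k : ℕ} (hk : k < p - 1) : ((k : ℚ) + 1) ^ 2 - (p : ℚ) ^ 2 ≠ 0 := by
  have h1 : (p : ℚ) + (k + 1) ≠ 0 := by positivity
  have := mul_ne_zero (sub_succ_ne_zero hk) h1
  intro h
  exact this (by linear_combination -h)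

section
variable {p : ℕ} [hp : Fact p.Prime]

lemma powDvd_inv_four (h : 2 < p) : PowDvd p 0 (4 : ℚ)⁻¹ := by
  have := (PowDvd.inv_natCast (p := p) (n := 2)
    (not_dvd_of_prime_lt Nat.prime_two h)).pow 2
  norm_num at this
  convert this using 1
  norm_num

lemma powDvd_inv_sq_sub {k : ℕ} (hk : k < p - 1) :
    PowDvd p 0 (((k : ℚ) + 1) ^ 2 - (p : ℚ) ^ 2)⁻¹ := by
  have h := ((powDvd_inv_sub_succ hk).mul_int (powDvd_inv_add_succ hk)).neg
  convert h using 1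
  rw [← mul_inv, ← inv_neg]
  congr 1
  ring

lemma powDvd_inv_sq_sub_quarter {k : ℕ} (hk : k < p - 1) (h2 : 2 < p) :
    PowDvd p 0 (((k : ℚ) + 1) ^ 2 - (p : ℚ) ^ 2 / 4)⁻¹ := by
  have hd : ¬ (p : ℤ) ∣ 2 * (k + 1) := fun h => by
    have h : p ∣ 2 * (k + 1) := by exact_mod_cast h
    rcases (Nat.Prime.dvd_mul hp.out).1 h with h | h
    · exact absurd (Nat.le_of_dvd (by norm_num) h) (by omega)
    · exact absurd (Nat.le_of_dvd (by omega) h) (by omega)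
  have h1 := PowDvd.inv_intCast (p := p) (n := 2 * (k + 1) - p)
    fun h => hd ((dvd_sub_left (dvd_refl _)).1 h)
  have h2 := PowDvd.inv_intCast (p := p) (n := 2 * (k + 1) + p)
    fun h => hd ((dvd_add_left (dvd_refl _)).1 h)
  have h := (h1.mul_int h2).mul_int (PowDvd.natCast 4)
  convert h using 1
  rw [← mul_inv]
  have : ((k : ℚ) + 1) ^ 2 - (p : ℚ) ^ 2 / 4 =
      ((2 * (k + 1) - p : ℤ) : ℚ) * ((2 * (k + 1) + p : ℤ) : ℚ) * 4⁻¹ := by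
    push_cast; ring
  rw [this, mul_inv, inv_inv]
  norm_num

lemma powDvd_sqProd_div_factorial {k : ℕ} (hk : k ≤ p - 1) :
    PowDvd p 4 (sqProd ((p : ℚ) ^ 2) k / (k.factorial : ℚ) ^ 2 - (1 - p ^ 2 * sqSum k)) := by
  have := PowDvd.prod_sub_first_order (p := p) (f := fun m => 1 - (p : ℚ) ^ 2 / ((m : ℚ) + 1) ^ 2)
    (b := fun m => -(1 / ((m : ℚ) + 1) ^ 2)) k
    (fun m hm => (powDvd_one_div_succ_pow (by omega) 2).neg)
    fun m _ => by convert PowDvd.zero (p := p) using 1; ring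
  rw [sqProd_div_factorial_sq]
  rw [sum_neg_distrib] at this
  convert this using 1
  rw [sqSum]
  ring

/-- For the full product the p⁴ coefficient is divisible by p by `powDvd_sum_mul_sqSum`, which gains
one power over the partial products. -/
lemma powDvd_sqProd_div_factorial_full (h5 : 5 < p) :
    PowDvd p 5 (sqProd ((p : ℚ) ^ 2) (p - 1) / ((p - 1).factorial : ℚ) ^ 2
      - (1 - p ^ 2 * hsum p 2)) := by
  have := PowDvd.prod_sub_second_order (p := p) (f := fun m => 1 - (p : ℚ) ^ 2 / ((m : ℚ) + 1) ^ 2)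
    (b := fun m => -(1 / ((m : ℚ) + 1) ^ 2)) (d := 0) (p - 1)
    (fun m hm => (powDvd_one_div_succ_pow (by omega) 2).neg)
    (fun m _ => PowDvd.zero)
    fun m _ => by convert PowDvd.zero (p := p) using 1; simp only [Pi.zero_apply]; ring
  rw [sqProd_div_factorial_sq]
  simp only [sum_neg_distrib, Pi.zero_apply, zero_add, neg_mul_neg] at this
  convert (this.mono (show (5 : ℤ) ≤ 6 by norm_num)).add
    (PowDvd.pow_mul' (n := 4) (powDvd_sum_mul_sqSum h5)) using 1
  rw [hsum]
  simp only [sqSum]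
  ring

lemma powDvd_factorial_div_sqProd {k : ℕ} (hk : k ≤ p - 1) :
    PowDvd p 4 ((k.factorial : ℚ) ^ 2 / sqProd ((p : ℚ) ^ 2) k - (1 + p ^ 2 * sqSum k)) := by
  rw [← sqProd_zero_left, sqProd_div_sqProd]
  refine PowDvd.prod_sub_first_order k (fun m hm => powDvd_one_div_succ_pow (by omega) 2)
    fun m hm => ?_
  have hm : m < p - 1 := by omega
  have h0 := sq_sub_sq_ne_zero hm
  exact .of_eq_pow_mul 4 (((powDvd_inv_succ hm).pow 2).mul_int (powDvd_inv_sq_sub hm))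
    (by field_simp; ring)

/-- Each factor is 1 - (3/4)p²/(m² - p²/4). -/
lemma powDvd_sqProd_div_sqProd {k : ℕ} (hk : k ≤ p - 1) (h2 : 2 < p) (hodd : Odd p) :
    PowDvd p 4 (sqProd ((p : ℚ) ^ 2) k / sqProd ((p : ℚ) ^ 2 / 4) k
      - (1 - 3 / 4 * p ^ 2 * sqSum k)) := by
  have h34 : PowDvd p 0 (-(3 / 4 : ℚ)) := by
    convert ((PowDvd.natCast (p := p) 3).mul_int (powDvd_inv_four h2)).neg using 1
    norm_num [div_eq_mul_inv]
  have := PowDvd.prod_sub_first_order (p := p)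
    (f := fun m => (((m : ℚ) + 1) ^ 2 - (p : ℚ) ^ 2) / (((m : ℚ) + 1) ^ 2 - (p : ℚ) ^ 2 / 4))
    (b := fun m => -(3 / 4) * (1 / ((m : ℚ) + 1) ^ 2)) k
    (fun m hm => h34.mul_int (powDvd_one_div_succ_pow (by omega) 2))
    fun m hm => by
      have hm : m < p - 1 := by omega
      have h0 := sq_sub_odd_sq_div_four_ne_zero hodd m
      refine .of_eq_pow_mul 4 (((h34.mul_int (powDvd_inv_four h2)).mul_int
        ((powDvd_inv_succ hm).pow 2)).mul_int (powDvd_inv_sq_sub_quarter hm h2)) ?_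
      generalize hX : ((m : ℚ) + 1) ^ 2 - (p : ℚ) ^ 2 / 4 = X at h0 ⊢
      have hX' : (p : ℚ) ^ 2 = 4 * (((m : ℚ) + 1) ^ 2 - X) := by rw [← hX]; ring
      rw [show (p : ℚ) ^ 4 = ((p : ℚ) ^ 2) ^ 2 by ring, hX']
      field_simp
      ring
  rw [sqProd_div_sqProd]
  rw [← mul_sum] at this
  convert this using 1
  rw [sqSum]
  ring

lemma powDvd_factorial_div_sqProd_full (h5 : 5 < p) (hodd : Odd p) :
    PowDvd p 5 (((p - 1).factorial : ℚ) ^ 2 / sqProd ((p : ℚ) ^ 2 / 4) (p - 1)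
      - (1 + p ^ 2 / 4 * hsum p 2)) := by
  have h2 : 2 < p := by omega
  have h4 := powDvd_inv_four h2
  have := PowDvd.prod_sub_second_order (p := p)
    (f := fun m => (((m : ℚ) + 1) ^ 2 - 0) / (((m : ℚ) + 1) ^ 2 - (p : ℚ) ^ 2 / 4))
    (b := fun m => 4⁻¹ * (1 / ((m : ℚ) + 1) ^ 2))
    (d := fun m => 4⁻¹ * 4⁻¹ * (1 / ((m : ℚ) + 1) ^ 4)) (p - 1)
    (fun m hm => h4.mul_int (powDvd_one_div_succ_pow (by omega) 2))
    (fun m hm => (h4.mul_int h4).mul_int (powDvd_one_div_succ_pow (by omega) 4))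
    fun m hm => by
      have h0 := sq_sub_odd_sq_div_four_ne_zero hodd m
      refine .of_eq_pow_mul 6 (((h4.pow 3).mul_int
        ((powDvd_inv_succ hm).pow 4)).mul_int (powDvd_inv_sq_sub_quarter hm h2)) ?_
      generalize hX : ((m : ℚ) + 1) ^ 2 - (p : ℚ) ^ 2 / 4 = X at h0 ⊢
      have hX' : (p : ℚ) ^ 2 = 4 * (((m : ℚ) + 1) ^ 2 - X) := by rw [← hX]; ring
      rw [show (p : ℚ) ^ 4 = ((p : ℚ) ^ 2) ^ 2 by ring,
        show (p : ℚ) ^ 6 = ((p : ℚ) ^ 2) ^ 3 by ring, hX']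
      field_simp
      ring
  rw [← sqProd_zero_left, sqProd_div_sqProd]
  have e : ∑ m ∈ range (p - 1), ((4⁻¹ : ℚ) * 4⁻¹ * (1 / ((m : ℚ) + 1) ^ 4)
      + 4⁻¹ * (1 / ((m : ℚ) + 1) ^ 2) * ∑ i ∈ range m, 4⁻¹ * (1 / ((i : ℚ) + 1) ^ 2)) =
      4⁻¹ * 4⁻¹ * (hsum p 4 + ∑ k ∈ range (p - 1), 1 / ((k : ℚ) + 1) ^ 2 * sqSum k) := by
    rw [hsum, ← sum_add_distrib, mul_sum]
    refine sum_congr rfl fun m _ => ?_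
    rw [← mul_sum, sqSum]
    ring
  obtain ⟨t, ht⟩ := hodd
  have hE := PowDvd.pow_mul' (n := 4) ((h4.mul_int h4).int_mul
    ((powDvd_power_four ht h5).1.add (powDvd_sum_mul_sqSum h5)))
  rw [e, ← mul_sum] at this
  convert (this.mono (show (5 : ℤ) ≤ 6 by norm_num)).add hE using 1
  rw [hsum]
  ring

end

/-! ### The linear congruences and the elimination -/

/-- The sum `∑_{k=1}^{p-1} 1 / (k^s C(2k, k))`. -/
def invBinomSum (p s : ℕ) : ℚ :=
  ∑ k ∈ range (p - 1), 1 / ((k : ℚ) + 1) ^ s * ((k + 1).centralBinom : ℚ)⁻¹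

/-- The sum `∑_{k=1}^{p-1} (∑_{m<k} 1 / m²) / (k² C(2k, k))`. -/
def invBinomSqSum (p : ℕ) : ℚ :=
  ∑ k ∈ range (p - 1), 1 / ((k : ℚ) + 1) ^ 2 * sqSum k * ((k + 1).centralBinom : ℚ)⁻¹

/-- The sum `∑_{k=1}^{p-1} (∑_{m<k} 1 / m²) / (p - k)`. -/
def reflectedSqSum (p : ℕ) : ℚ :=
  ∑ k ∈ range (p - 1), sqSum k * (1 / ((p : ℚ) - (k + 1)))

/-- The alternating sum `∑_{k=1}^{p-1} (-1)^(k-1) / k^s`. -/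
def altSum (p s : ℕ) : ℚ := ∑ k ∈ range (p - 1), (-1) ^ k * (1 / ((k : ℚ) + 1) ^ s)

lemma choose_mul_choose_eq {p k : ℕ} (hk : k < p - 1) :
    (-1 : ℚ) ^ (k + 1) * p.choose (k + 1) * (p + (k + 1)).choose p =
      -((p * (1 / ((k : ℚ) + 1)) + p ^ 2 * (1 / ((k : ℚ) + 1) ^ 2))
        * (sqProd ((p : ℚ) ^ 2) k / (k.factorial : ℚ) ^ 2)) := by
  have h := cast_factorial_add (p := p) (k := k) (by omega)
  rw [show p - 1 - k = p - (k + 1) by omega] at h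
  have hf : ((p + (k + 1)).factorial : ℚ) = ((p : ℚ) + (k + 1)) * (p + k).factorial := by
    rw [← add_assoc, Nat.factorial_succ]
    push_cast
    ring
  rw [Nat.cast_choose ℚ (show k + 1 ≤ p by omega), Nat.cast_add_choose, hf, h,
    Nat.factorial_succ k]
  have h1 : (k.factorial : ℚ) ≠ 0 := by positivity
  have h2 : (p.factorial : ℚ) ≠ 0 := by positivity
  have h3 : ((p - (k + 1)).factorial : ℚ) ≠ 0 := by positivity
  have h4 : (k : ℚ) + 1 ≠ 0 := by positivity
  have s3 : (-1 : ℚ) ^ k * (-1) ^ k = 1 := by rw [← mul_pow]; norm_num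
  rw [pow_succ]
  push_cast
  field_simp
  linear_combination -(p : ℚ) * (p + k + 1) * sqProd ((p : ℚ) ^ 2) k * s3

section
variable {p : ℕ} [hp : Fact p.Prime]

/-- In the Legendre identity of degree p, the end terms give 1 - C(2p,p) and each middle term is
expanded by `choose_mul_choose_eq`. Using 1/(p-k) ≡ -1/k - p/k² mod p² puts the p³ and p⁴
contributions into the single sum R, the same one that arises at x = 0. -/
lemma powDvd_reflectedSqSum (h5 : 5 < p) :
    PowDvd p 5 (p * hsum p 1 - p ^ 2 * hsum p 2 + p ^ 3 * reflectedSqSum p) := by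
  have hodd := hp.out.odd_of_ne_two (by omega)
  have hL : (∑ k ∈ range (p + 1), (-1 : ℚ) ^ k * p.choose k * (p + k).choose p) = -1 := by
    have := sum_neg_one_pow_choose_mul_choose p
    rw [hodd.neg_one_pow] at this
    exact_mod_cast this
  have hsplit : ∀ g : ℕ → ℚ, ∑ k ∈ range (p + 1), g k =
      ∑ k ∈ range (p - 1), g (k + 1) + g 0 + g p := fun g => by
    rw [sum_range_succ]
    congr 1
    conv_lhs => rw [show p = p - 1 + 1 by omega]
    exact sum_range_succ' _ _
  have hL2 : (1 : ℚ) + ∑ k ∈ range (p - 1), (-1 : ℚ) ^ (k + 1) * p.choose (k + 1)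
      * (p + (k + 1)).choose p - p.centralBinom = -1 := by
    rw [hsplit, hodd.neg_one_pow, Nat.choose_self, ← two_mul,
      ← Nat.centralBinom_eq_two_mul_choose] at hL
    simp only [pow_zero, Nat.choose_zero_right, add_zero, Nat.choose_self, Nat.cast_one] at hL
    linear_combination hL
  rw [sum_congr rfl fun k hk => choose_mul_choose_eq (mem_range.1 hk), sum_neg_distrib,
    cast_centralBinom_eq hodd] at hL2
  have hterm := powDvd_sum_of_forall (p := p) (k := 5) (n := p - 1)
    (f := fun k => (p * (1 / ((k : ℚ) + 1)) + p ^ 2 * (1 / ((k : ℚ) + 1) ^ 2))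
        * (sqProd ((p : ℚ) ^ 2) k / (k.factorial : ℚ) ^ 2) - (p * (1 / ((k : ℚ) + 1) ^ 1)
        + p ^ 2 * (1 / ((k : ℚ) + 1) ^ 2) + p ^ 3 * (sqSum k * (1 / ((p : ℚ) - (k + 1))))))
    fun k hk => by
      have h1 := PowDvd.pow_mul' (n := 1) (((powDvd_one_div_succ_pow hk 1).add
        ((PowDvd.natCast p).mul_int (powDvd_one_div_succ_pow hk 2))).int_mul
        (powDvd_sqProd_div_factorial hk.le))
      have h2 := PowDvd.pow_mul (n := 5) ((powDvd_sqSum hk.le).mul_int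
        ((powDvd_one_div_succ_pow hk 2).mul_int (powDvd_inv_sub_succ hk)))
      have h0 := sub_succ_ne_zero hk
      refine .of_eq (h1.sub h2) ?_
      field_simp
      ring
  rw [sum_sub_distrib, sum_add_distrib, sum_add_distrib, ← mul_sum, ← mul_sum, ← mul_sum] at hterm
  change PowDvd p 5 (_ - (p * hsum p 1 + p ^ 2 * hsum p 2 + p ^ 3 * reflectedSqSum p)) at hterm
  have hC := (PowDvd.natCast (p := p) 2).int_mul (powDvd_sqProd_div_factorial_full h5)
  convert (hterm.add hC).neg using 1
  push_cast
  linear_combination -hL2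

/-- The alternating identity at x = 0, N = p - 1. Its remainder becomes a sum of k!²/∏(m² - p²) ·
1/(p-k), whose expansion yields H_1 + p²R. -/
lemma powDvd_of_sqProd_zero (h5 : 5 < p) :
    PowDvd p 4 (2 * p * altSum p 2 - 3 * p * invBinomSum p 2 + hsum p 1
      + p ^ 2 * reflectedSqSum p) := by
  have hodd := hp.out.odd_of_ne_two (by omega)
  have hev : Even (p - 1) := hodd.tsub_odd odd_one
  have hid := sum_alternating_inv_sub 0 (p - 1) fun n _ => by
    rw [sub_zero]; positivity
  have hA : ∑ n ∈ range (p - 1), (-1 : ℚ) ^ n / (((n : ℚ) + 1) ^ 2 - 0) = altSum p 2 :=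
    sum_congr rfl fun n _ => by rw [sub_zero]; ring
  have hS : ∑ k ∈ range (p - 1), sqProd 0 k / (k.factorial : ℚ) ^ 2 / (k + 1).centralBinom
          * (2 / (((k : ℚ) + 1) ^ 2 - 0) - 1 / (2 * ((k : ℚ) + 1) ^ 2)) =
        3 / 2 * invBinomSum p 2 := by
    rw [invBinomSum, mul_sum]
    refine sum_congr rfl fun k _ => ?_
    have h1 : (k.factorial : ℚ) ≠ 0 := by positivity
    rw [sqProd_zero_left, div_self (pow_ne_zero 2 h1), sub_zero]
    field_simp
    norm_num
  have hR : p * ∑ k ∈ range (p - 1), (-1 : ℚ) ^ (p - 1 + k + 1) * sqProd 0 k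
        * (p - 1 - 1 - k).factorial / (p - 1 + k + 1).factorial
      = -∑ k ∈ range (p - 1), (k.factorial : ℚ) ^ 2 / sqProd ((p : ℚ) ^ 2) k
          * (1 / ((p : ℚ) - (k + 1))) := by
    rw [mul_sum, ← sum_neg_distrib]
    refine sum_congr rfl fun k hk => ?_
    have hk := mem_range.1 hk
    have h0 := sub_succ_ne_zero hk
    have hs : sqProd ((p : ℚ) ^ 2) k ≠ 0 :=
      sqProd_ne_zero _ _ fun m hm => sq_sub_sq_ne_zero (by omega)
    rw [show p - 1 + k + 1 = p + k by omega, cast_factorial_add (by omega), sqProd_zero_left,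
      show p - 1 - k = (p - 1 - 1 - k) + 1 by omega, Nat.factorial_succ, Nat.cast_mul,
      Nat.cast_succ, cast_sub_succ hk, pow_add, hodd.neg_one_pow]
    have h1 : ((p - 1 - 1 - k).factorial : ℚ) ≠ 0 := by positivity
    have h2 : (p : ℚ) ≠ 0 := by exact_mod_cast hp.out.ne_zero
    have s3 : (-1 : ℚ) ^ k ≠ 0 := pow_ne_zero _ (by norm_num)
    field_simp
  have hterm := powDvd_sum_of_forall (p := p) (k := 4) (n := p - 1)
    (f := fun k => (k.factorial : ℚ) ^ 2 / sqProd ((p : ℚ) ^ 2) k * (1 / ((p : ℚ) - (k + 1)))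
      - (1 / ((p : ℚ) - (k + 1)) + p ^ 2 * (sqSum k * (1 / ((p : ℚ) - (k + 1))))))
    fun k hk => by
      have := (powDvd_factorial_div_sqProd hk.le).mul_int (powDvd_inv_sub_succ hk)
      convert this using 1
      ring
  have hH : ∑ k ∈ range (p - 1), 1 / ((p : ℚ) - (k + 1)) = hsum p 1 := by
    rw [sum_range_reflect_pred p (fun x => 1 / x)]
    simp [hsum]
  rw [sum_sub_distrib, sum_add_distrib, ← mul_sum, hH] at hterm
  change PowDvd p 4 (_ - (hsum p 1 + p ^ 2 * reflectedSqSum p)) at hterm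
  rw [hA, hS] at hid
  convert hterm.neg using 1
  linear_combination 2 * p * hid + hR

/-- The alternating identity at x = p². Here the products cancel in the remainder, which is exactly
-H_1 after multiplication by p; I_4 and S are the p² coefficients of the main sum. -/
lemma powDvd_of_sqProd_sq (h5 : 5 < p) :
    PowDvd p 4 (2 * p * altSum p 2 - 3 * p * invBinomSum p 2
      - p ^ 3 * (4 * invBinomSum p 4 - 3 * invBinomSqSum p) + hsum p 1) := by
  have hodd := hp.out.odd_of_ne_two (by omega)
  have hid := sum_alternating_inv_sub ((p : ℚ) ^ 2) (p - 1) fun n hn => sq_sub_sq_ne_zero hn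
  have hR : p * ∑ k ∈ range (p - 1), (-1 : ℚ) ^ (p - 1 + k + 1) * sqProd ((p : ℚ) ^ 2) k
        * (p - 1 - 1 - k).factorial / (p - 1 + k + 1).factorial = -hsum p 1 := by
    have hH : hsum p 1 = ∑ k ∈ range (p - 1), 1 / ((p : ℚ) - (k + 1)) := by
      rw [sum_range_reflect_pred p (fun x => 1 / x)]
      simp [hsum]
    rw [mul_sum, hH, ← sum_neg_distrib]
    refine sum_congr rfl fun k hk => ?_
    have hk := mem_range.1 hk
    have h0 := sub_succ_ne_zero hk
    have hs : sqProd ((p : ℚ) ^ 2) k ≠ 0 :=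
      sqProd_ne_zero _ _ fun m hm => sq_sub_sq_ne_zero (by omega)
    rw [show p - 1 + k + 1 = p + k by omega, cast_factorial_add (by omega),
      show p - 1 - k = (p - 1 - 1 - k) + 1 by omega, Nat.factorial_succ, Nat.cast_mul,
      Nat.cast_succ, cast_sub_succ hk, pow_add, hodd.neg_one_pow]
    have h1 : ((p - 1 - 1 - k).factorial : ℚ) ≠ 0 := by positivity
    have h2 : (p : ℚ) ≠ 0 := by exact_mod_cast hp.out.ne_zero
    have s3 : (-1 : ℚ) ^ k ≠ 0 := pow_ne_zero _ (by norm_num)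
    field_simp
  have hA := powDvd_sum_of_forall (p := p) (k := 4) (n := p - 1)
    (f := fun k => (-1 : ℚ) ^ k / (((k : ℚ) + 1) ^ 2 - p ^ 2)
      - ((-1) ^ k * (1 / ((k : ℚ) + 1) ^ 2) + p ^ 2 * ((-1) ^ k * (1 / ((k : ℚ) + 1) ^ 4))))
    fun k hk => by
      have h0 := sq_sub_sq_ne_zero hk
      exact .of_eq_pow_mul 4 (((PowDvd.one.neg.pow k).mul_int ((powDvd_inv_succ hk).pow 4)).mul_int
        (powDvd_inv_sq_sub hk)) (by field_simp; ring)
  have hS := powDvd_sum_of_forall (p := p) (k := 3) (n := p - 1)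
    (f := fun k => 2 * (sqProd ((p : ℚ) ^ 2) k / (k.factorial : ℚ) ^ 2 / (k + 1).centralBinom
          * (2 / (((k : ℚ) + 1) ^ 2 - p ^ 2) - 1 / (2 * ((k : ℚ) + 1) ^ 2)))
        - (3 * (1 / ((k : ℚ) + 1) ^ 2 * ((k + 1).centralBinom : ℚ)⁻¹)
          + p ^ 2 * 4 * (1 / ((k : ℚ) + 1) ^ 4 * ((k + 1).centralBinom : ℚ)⁻¹)
          - p ^ 2 * 3 * (1 / ((k : ℚ) + 1) ^ 2 * sqSum k * ((k + 1).centralBinom : ℚ)⁻¹)))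
    fun k hk => by
      have h0 := sq_sub_sq_ne_zero hk
      have hC := PowDvd.inv_centralBinom (p := p) (n := k + 1) (by omega)
      have hi := powDvd_inv_sq_sub hk
      have hs := powDvd_sqSum (p := p) hk.le
      have hp2 := (PowDvd.natCast (p := p) p).pow 2
      have h4 := PowDvd.natCast (p := p) 4
      have hQ := (powDvd_sqProd_div_factorial hk.le).mul_int
        ((h4.mul_int hi).sub (powDvd_one_div_succ_pow hk 2))
      have hG := (PowDvd.one.sub (hp2.mul_int hs)).int_mul (PowDvd.pow_mul (n := 4)
        ((h4.mul_int ((powDvd_inv_succ hk).pow 4)).mul_int hi))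
      have hE := PowDvd.pow_mul (n := 4) ((h4.mul_int hs).mul_int (powDvd_one_div_succ_pow hk 4))
      refine .of_eq (((hQ.add hG).sub hE).mul hC) ?_
      push_cast
      generalize sqProd ((p : ℚ) ^ 2) k / (k.factorial : ℚ) ^ 2 = Q
      have hc : ((k + 1).centralBinom : ℚ) ≠ 0 := by exact_mod_cast Nat.centralBinom_ne_zero _
      field_simp
      ring
  rw [sum_sub_distrib, sum_add_distrib, ← mul_sum] at hA
  rw [sum_sub_distrib, sum_sub_distrib, sum_add_distrib, ← mul_sum, ← mul_sum, ← mul_sum,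
    ← mul_sum] at hS
  change PowDvd p 4 (_ - (altSum p 2 + p ^ 2 * altSum p 4)) at hA
  change PowDvd p 3 (_ - (3 * invBinomSum p 2 + p ^ 2 * 4 * invBinomSum p 4
    - p ^ 2 * 3 * invBinomSqSum p)) at hS
  obtain ⟨t, ht⟩ := hodd
  have h4 : PowDvd p 1 (altSum p 4) := (powDvd_power_four ht h5).2.2
  have h4' := (PowDvd.natCast (p := p) 2).int_mul (PowDvd.pow_mul' (n := 3) h4)
  have hA' := (PowDvd.natCast (p := p) 2).int_mul ((PowDvd.natCast p).int_mul hA)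
  have hS' := PowDvd.pow_mul' (n := 1) hS
  convert (hS'.sub hA').sub h4' using 1
  push_cast
  linear_combination 2 * p * hid + hR

lemma powDvd_of_oddTerm (h5 : 5 < p) :
    PowDvd p 3 (12 * invBinomSum p 2 + 3 * p ^ 2 * invBinomSum p 4 - 9 * p ^ 2 * invBinomSqSum p
      + 2 * hsum p 2) := by
  have hodd := hp.out.odd_of_ne_two (by omega)
  have hid := three_mul_sum_oddTerm hodd
  have hp0 : (p : ℚ) ≠ 0 := by exact_mod_cast hp.out.ne_zero
  -- The last term k = p is singular: its p⁻² part cancels the 2/p² of the identity. As p² is then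
  -- divided out, its product is needed mod p⁵.
  have hlast : 3 * p ^ 2 * oddTerm (p : ℚ) (p - 1) =
      2 * (((p - 1).factorial : ℚ) ^ 2 / sqProd ((p : ℚ) ^ 2 / 4) (p - 1)) := by
    have h1 : sqProd ((p : ℚ) ^ 2) (p - 1) ≠ 0 :=
      sqProd_ne_zero _ _ fun m hm => sq_sub_sq_ne_zero hm
    have h2 : sqProd ((p : ℚ) ^ 2 / 4) (p - 1) ≠ 0 :=
      sqProd_ne_zero _ _ fun m _ => sq_sub_odd_sq_div_four_ne_zero hodd m
    have h3 : ((p - 1).factorial : ℚ) ≠ 0 := by positivity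
    have h4 : ((p - 1 : ℕ) : ℚ) + 1 = p := by exact_mod_cast (show p - 1 + 1 = p by omega)
    rw [oddTerm, sqProd_succ, h4, show p - 1 + 1 = p by omega, cast_centralBinom_eq hodd]
    have h6 : (p : ℚ) ^ 2 - p ^ 2 / 4 = 3 / 4 * p ^ 2 := by ring
    rw [h6]
    field_simp
    norm_num
  have hsplit : ∑ k ∈ range p, oddTerm (p : ℚ) k =
      ∑ k ∈ range (p - 1), oddTerm (p : ℚ) k + oddTerm (p : ℚ) (p - 1) := by
    conv_lhs => rw [show p = p - 1 + 1 by omega, sum_range_succ]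
    rw [show p - 1 + 1 = p by omega]
  have h2 : 2 < p := by omega
  have hS := powDvd_sum_of_forall (p := p) (k := 3) (n := p - 1)
    (f := fun k => 4 * oddTerm (p : ℚ) k
        - (4 * (1 / ((k : ℚ) + 1) ^ 2 * ((k + 1).centralBinom : ℚ)⁻¹)
          + p ^ 2 * (1 / ((k : ℚ) + 1) ^ 4 * ((k + 1).centralBinom : ℚ)⁻¹)
          - p ^ 2 * 3 * (1 / ((k : ℚ) + 1) ^ 2 * sqSum k * ((k + 1).centralBinom : ℚ)⁻¹)))
    fun k hk => by
      have h0 := sq_sub_odd_sq_div_four_ne_zero hodd k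
      have hC := PowDvd.inv_centralBinom (p := p) (n := k + 1) (by omega)
      have hi := powDvd_inv_sq_sub_quarter hk h2
      have hs := powDvd_sqSum (p := p) hk.le
      have hp2 := (PowDvd.natCast (p := p) p).pow 2
      have h4 := powDvd_inv_four h2
      have h34 := (PowDvd.natCast (p := p) 3).mul_int h4
      have hQ := ((PowDvd.natCast (p := p) 4).mul_int hi).int_mul
        (powDvd_sqProd_div_sqProd hk.le h2 hodd)
      have hG := (PowDvd.one.sub ((h34.mul_int hp2).mul_int hs)).int_mul (PowDvd.pow_mul (n := 4)
        ((h4.mul_int ((powDvd_inv_succ hk).pow 4)).mul_int hi))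
      have hE := PowDvd.pow_mul (n := 4) ((h34.mul_int hs).mul_int (powDvd_one_div_succ_pow hk 4))
      refine .of_eq (((hQ.add hG).sub hE).mul hC) ?_
      have hD : sqProd ((p : ℚ) ^ 2 / 4) k ≠ 0 :=
        sqProd_ne_zero _ _ fun m _ => sq_sub_odd_sq_div_four_ne_zero hodd m
      have hc : ((k + 1).centralBinom : ℚ) ≠ 0 := by exact_mod_cast Nat.centralBinom_ne_zero _
      have hO : oddTerm (p : ℚ) k = sqProd ((p : ℚ) ^ 2) k / sqProd ((p : ℚ) ^ 2 / 4) k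
          * (((k : ℚ) + 1) ^ 2 - p ^ 2 / 4)⁻¹ * ((k + 1).centralBinom : ℚ)⁻¹ := by
        rw [oddTerm, sqProd_succ]
        field_simp
      rw [hO]
      generalize sqProd ((p : ℚ) ^ 2) k / sqProd ((p : ℚ) ^ 2 / 4) k = Q
      generalize hX : ((k : ℚ) + 1) ^ 2 - (p : ℚ) ^ 2 / 4 = X at h0 ⊢
      have hX' : (p : ℚ) ^ 2 = 4 * (((k : ℚ) + 1) ^ 2 - X) := by rw [← hX]; ring
      rw [show (p : ℚ) ^ 4 = ((p : ℚ) ^ 2) ^ 2 by ring, hX']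
      push_cast
      field_simp
      ring
  rw [sum_sub_distrib, sum_sub_distrib, sum_add_distrib, ← mul_sum, ← mul_sum, ← mul_sum,
    ← mul_sum] at hS
  change PowDvd p 3 (_ - (4 * invBinomSum p 2 + p ^ 2 * invBinomSum p 4
    - p ^ 2 * 3 * invBinomSqSum p)) at hS
  have hF := powDvd_factorial_div_sqProd_full h5 hodd
  have key : PowDvd p 3 (12 * ∑ k ∈ range (p - 1), oddTerm (p : ℚ) k + 2 * hsum p 2) := by
    have h8 := ((PowDvd.natCast (p := p) 8).int_mul hF).neg
    refine PowDvd.of_pow_mul (p := p) (n := 2) (k := 5) ?_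
    convert h8 using 1
    rw [hsplit, eq_div_iff (pow_ne_zero 2 hp0)] at hid
    push_cast
    linear_combination 4 * hid - 4 * hlast
  convert key.sub ((PowDvd.natCast (p := p) 3).int_mul hS) using 1
  push_cast
  ring

lemma powDvd_invBinomSum_four (h5 : 5 < p) :
    PowDvd p 4 (p ^ 3 * invBinomSum p 4 - hsum p 1) := by
  have e0 := powDvd_of_sqProd_zero h5
  have e1 := (PowDvd.natCast (p := p) 3).int_mul (powDvd_of_sqProd_sq h5)
  have eB := PowDvd.pow_mul' (n := 1) (powDvd_of_oddTerm h5)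
  have eC : PowDvd p 4 (hsum p 1 - p * hsum p 2 + p ^ 2 * reflectedSqSum p) := by
    refine PowDvd.of_pow_mul (p := p) (n := 1) (k := 5) ?_
    convert powDvd_reflectedSqSum h5 using 1
    ring
  have eH := (PowDvd.natCast (p := p) 3).int_mul (powDvd_hsum_one_add h5)
  have eA := (PowDvd.natCast (p := p) 2).int_mul (PowDvd.pow_mul' (n := 1) (powDvd_power_two h5).2)
  change PowDvd p 4 (_ * (_ * (4 * altSum p 2 + 3 * hsum p 2))) at eA
  have h3 := not_dvd_of_prime_lt (p := p) Nat.prime_three (by omega)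
  -- In the combination below A, I_2, S, R and H_2 cancel, leaving 9(H_1 - p³ I_4).
  refine PowDvd.of_natCast_mul (n := 3) h3 (PowDvd.of_natCast_mul (n := 3) h3 ?_)
  have := ((((e1.add eB).add e0).sub eA).sub eC).add eH
  convert this.neg using 1
  push_cast
  ring

end

/-! ### Reflection k ↦ p - k and the second congruence -/

lemma sum_Icc_one_pred_eq (p : ℕ) (f : ℕ → ℚ) :
    ∑ k ∈ Icc 1 (p - 1), f k = ∑ k ∈ range (p - 1), f (k + 1) := by
  rw [← Ico_succ_right_eq_Icc, sum_Ico_eq_sum_range]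
  refine sum_congr (by simp) fun k _ => by rw [add_comm]

lemma harmonic_pred_eq_hsum (p : ℕ) : harmonic (p - 1) = hsum p 1 :=
  sum_congr rfl fun k _ => by push_cast; simp

lemma sum_range_two_mul_reflect (f : ℕ → ℚ) (t : ℕ) :
    ∑ k ∈ range (2 * t), f (k + 1) =
      ∑ k ∈ range t, (f (k + 1) + f (2 * t + 1 - (k + 1))) := by
  rw [two_mul, sum_range_add, sum_add_distrib]
  congr 1
  rw [← sum_range_reflect]
  refine sum_congr rfl fun k hk => ?_
  have := mem_range.1 hk
  congr 1
  omega

section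
variable {p : ℕ} [hp : Fact p.Prime]

lemma powDvd_inv_centralBinom_of_lt {j : ℕ} (hj : 2 * j < p) :
    PowDvd p 0 ((j.centralBinom : ℚ)⁻¹) := by
  refine PowDvd.inv_natCast fun h => ?_
  have h1 := Nat.choose_mul_factorial_mul_factorial (show j ≤ 2 * j by omega)
  rw [← Nat.centralBinom_eq_two_mul_choose] at h1
  have h2 : p ∣ (2 * j).factorial := h1 ▸ ((h.mul_right _).mul_right _)
  exact absurd ((Nat.Prime.dvd_factorial hp.out).1 h2) (by omega)

/-- Induction on k. The base case uses C(2p,p) ≡ 2 mod p, which gives C(2p-2,p-1) ≡ -p mod p². The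
central binomial recurrence, applied upwards to one factor and downwards to the other, multiplies
the product by a number ≡ 1 mod p. -/
lemma powDvd_centralBinom_mul_add (h5 : 5 < p) {k : ℕ} (hk : 2 * (k + 1) < p) :
    PowDvd p 2 (((k : ℚ) + 1) * (k + 1).centralBinom * (p - (k + 1)).centralBinom + 2 * p) := by
  have hodd := hp.out.odd_of_ne_two (by omega)
  induction k with
  | zero =>
    have h := Nat.succ_mul_centralBinom_succ (p - 1)
    rw [show p - 1 + 1 = p by omega] at h
    have h1 : (p : ℚ) * p.centralBinom = 2 * (2 * ((p : ℚ) - 1) + 1) * (p - 1).centralBinom := by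
      have : ((p - 1 : ℕ) : ℚ) = (p : ℚ) - 1 := by rw [Nat.cast_sub (by omega)]; simp
      rw [← this]
      exact_mod_cast h
    have hu : ¬ (p : ℤ) ∣ 2 * (p : ℤ) - 1 := fun hd => by
      have : (p : ℤ) ∣ 1 := by
        have := (dvd_sub_right (Dvd.intro_left 2 rfl)).1 hd
        exact this
      have := Int.le_of_dvd (by norm_num) this
      omega
    have h2 := PowDvd.inv_intCast hu
    have h3 := (powDvd_sqProd_div_factorial_full h5).mono (show (1 : ℤ) ≤ 5 by norm_num)
    have h4 : PowDvd p 1 (-(2 * (p : ℚ) ^ 2 * hsum p 2) + 4 * p) :=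
      .of_eq_pow_mul 1 (b := 4 - 2 * p * hsum p 2) ((PowDvd.natCast 4).sub
        (((PowDvd.natCast 2).mul_int (PowDvd.natCast p)).mul_int (powDvd_hsum 2))) (by ring)
    have h5 := ((PowDvd.natCast (p := p) 2).int_mul h3).add h4
    refine .of_eq ((PowDvd.pow_mul' (n := 1) h5).mul_int h2) ?_
    rw [cast_centralBinom_eq hodd] at h1
    have h6 : (2 * (p : ℚ) - 1) ≠ 0 := by
      intro h0
      have : 2 * (p : ℤ) - 1 = 0 := by exact_mod_cast h0
      omega
    have c1 : Nat.centralBinom (0 + 1) = 2 := by decide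
    rw [c1, zero_add]
    generalize sqProd ((p : ℚ) ^ 2) (p - 1) / ((p - 1).factorial : ℚ) ^ 2 = Q at h1 ⊢
    push_cast
    field_simp
    linear_combination -h1
  | succ k ih =>
    have ih := ih (by omega)
    obtain ⟨m, hm⟩ : ∃ m, p = k + 1 + 1 + m := ⟨p - (k + 1 + 1), by omega⟩
    have e1 : p - (k + 1) = m + 1 := by omega
    have e2 : p - (k + 1 + 1) = m := by omega
    rw [e1] at ih
    rw [e2]
    have hpq : (p : ℚ) = k + 1 + 1 + m := by rw [hm]; push_cast; ring
    have h1 : ((k : ℚ) + 2) * (k + 1 + 1).centralBinom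
        = 2 * (2 * (k + 1) + 1) * (k + 1).centralBinom := by
      have := congrArg (Nat.cast : ℕ → ℚ) (Nat.succ_mul_centralBinom_succ (k + 1))
      push_cast at this
      linear_combination this
    have h2 : ((m : ℚ) + 1) * (m + 1).centralBinom = 2 * (2 * m + 1) * m.centralBinom := by
      exact_mod_cast Nat.succ_mul_centralBinom_succ m
    have hu : ¬ p ∣ 2 * m + 1 := fun hd => by
      have h3 : p ∣ (2 * m + 1) + (2 * (k + 1) + 1) := ⟨2, by omega⟩
      exact Nat.not_dvd_of_pos_of_lt (by omega) (by omega) ((Nat.dvd_add_right hd).1 h3)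
    have hE : PowDvd p 1 (((k : ℚ) + 1) * (k + 1).centralBinom * (m + 1).centralBinom) := by
      have h6 : PowDvd p 1 ((p : ℚ) * 2) :=
        .of_eq_pow_mul 1 (PowDvd.natCast 2) (by push_cast; ring)
      refine .of_eq ((ih.mono (show (1 : ℤ) ≤ 2 by norm_num)).sub h6) ?_
      ring
    -- With p = k + 2 + m, the ratio of consecutive products is 1 + p/((k+1)(2m+1)); the product
    -- itself is divisible by p, so the change is divisible by p².
    have hD := (PowDvd.pow_mul' (n := 1) hE).mul_int
      ((powDvd_inv_succ (p := p) (k := k) (by omega)).mul_int (PowDvd.inv_natCast hu))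
    refine .of_eq (ih.add hD) ?_
    have h7 : 2 * (m : ℚ) + 1 ≠ 0 := by positivity
    have h8 : (k : ℚ) + 1 ≠ 0 := by positivity
    have h9 : ((k + 1 + 1).centralBinom : ℚ) =
        2 * (2 * (k + 1) + 1) * (k + 1).centralBinom / (k + 2) := by
      rw [← h1]; field_simp
    have h10 : (m.centralBinom : ℚ) = (m + 1) * (m + 1).centralBinom / (2 * (2 * m + 1)) := by
      rw [h2]; field_simp
    have h11 : (k : ℚ) + 2 ≠ 0 := by positivity
    have h12 : (k : ℚ) + 1 + 1 ≠ 0 := by positivity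
    rw [h9, h10, hpq]
    push_cast
    field_simp
    ring

lemma powDvd_centralBinom_sub (h5 : 5 < p) {k : ℕ} (hk : 2 * (k + 1) < p) :
    PowDvd p 1 ((p - (k + 1)).centralBinom : ℚ) := by
  have h := (powDvd_centralBinom_mul_add h5 hk).mono (show (1 : ℤ) ≤ 2 by norm_num)
  have h6 : PowDvd p 1 ((p : ℚ) * 2) :=
    .of_eq_pow_mul 1 (PowDvd.natCast 2) (by push_cast; ring)
  refine .of_eq ((h.sub h6).mul_int ((powDvd_inv_succ (p := p) (k := k) (by omega)).mul_int
    (powDvd_inv_centralBinom_of_lt hk))) ?_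
  have h1 : ((k + 1).centralBinom : ℚ) ≠ 0 := by exact_mod_cast Nat.centralBinom_ne_zero _
  field_simp
  ring

lemma powDvd_inv_centralBinom_reflect (h5 : 5 < p) {k : ℕ} (hk : 2 * (k + 1) < p) :
    PowDvd p 1 (2 * p * (1 / ((p : ℚ) - (k + 1)) ^ 4 * ((p - (k + 1)).centralBinom : ℚ)⁻¹)
      + (k + 1).centralBinom / ((k : ℚ) + 1) ^ 3) := by
  have hk' : k < p - 1 := by omega
  have hw := PowDvd.pow_mul' (n := 1) (PowDvd.inv_centralBinom (p := p) (n := p - (k + 1)) (by omega))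
  have h1 := (PowDvd.natCast (p := p) 2).int_mul (powDvd_one_div_sub_pow_four hk')
  have hp0 : (p : ℚ) ≠ 0 := by exact_mod_cast hp.out.ne_zero
  have h2 : PowDvd p 1 ((((k : ℚ) + 1) * (k + 1).centralBinom * (p - (k + 1)).centralBinom
      + 2 * p) / p) := by
    refine PowDvd.of_pow_mul (n := 1) (k := 2) ?_
    rw [pow_one, mul_div_cancel₀ _ hp0]
    exact powDvd_centralBinom_mul_add h5 hk
  refine .of_eq ((h1.add (h2.mul_int (powDvd_one_div_succ_pow hk' 4))).mul hw) ?_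
  have h3 : ((p - (k + 1)).centralBinom : ℚ) ≠ 0 := by exact_mod_cast Nat.centralBinom_ne_zero _
  have h4 := sub_succ_ne_zero hk'
  push_cast
  field_simp
  ring

/-- Pair k < p/2 with p - k. The term of pI_4 at p - k matches C(2k,k)/k³; the other two vanish mod
p, since p divides C(2(p-k),p-k) but not C(2k,k). -/
lemma powDvd_sum_centralBinom_div_cube (h5 : 5 < p) :
    PowDvd p 1 (∑ k ∈ range (p - 1), ((k + 1).centralBinom : ℚ) / ((k : ℚ) + 1) ^ 3
      + 2 * p * invBinomSum p 4) := by
  obtain ⟨t, ht⟩ := hp.out.odd_of_ne_two (by omega)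
  have hpt : p - 1 = 2 * t := by omega
  have e1 := sum_range_two_mul_reflect (fun n => (n.centralBinom : ℚ) / (n : ℚ) ^ 3) t
  have e2 := sum_range_two_mul_reflect (fun n => 1 / (n : ℚ) ^ 4 * (n.centralBinom : ℚ)⁻¹) t
  rw [← ht] at e1 e2
  push_cast at e1 e2
  rw [invBinomSum, hpt, e1, e2, mul_sum, ← sum_add_distrib]
  refine powDvd_sum_of_forall fun k hk => ?_
  have hk2 : 2 * (k + 1) < p := by omega
  have hk' : k < p - 1 := by omega
  have hc : ((p - (k + 1) : ℕ) : ℚ) = (p : ℚ) - (k + 1) := by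
    rw [Nat.cast_sub (by omega)]; push_cast; ring
  rw [hc]
  have h1 := powDvd_inv_centralBinom_reflect h5 hk2
  have h2 := (powDvd_centralBinom_sub h5 hk2).mul_int ((powDvd_inv_sub_succ hk').pow 3)
  have h3 := PowDvd.pow_mul (n := 1) ((PowDvd.natCast (p := p) 2).mul_int
    ((powDvd_one_div_succ_pow hk' 4).mul_int (powDvd_inv_centralBinom_of_lt hk2)))
  refine .of_eq ((h1.add h2).add h3) ?_
  rw [inv_pow]
  push_cast
  ring

end

/-! ### The prime 5 and the conclusion -/

lemma ratModEq_five : RatModEq 5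
    (∑ k ∈ Icc 1 (5 - 1), (Nat.choose (2 * k) k : ℚ) / (k : ℚ) ^ 3)
    (-2 * harmonic (5 - 1) / ((5 : ℕ) : ℚ) ^ 2) := by
  refine ⟨821 / 864, by norm_num, ?_⟩
  rw [sum_Icc_one_pred_eq]
  simp only [harmonic, sum_range_succ, range_zero, sum_empty, Nat.add_one_sub_one]
  norm_num [Nat.choose]

theorem theorem2 (p : ℕ) (hp : p.Prime) (hp3 : 3 < p) :
    (p ≠ 5 → RatModEq p
      (∑ k ∈ Finset.Icc 1 (p - 1), 1 / ((k : ℚ) ^ 4 * (Nat.choose (2 * k) k : ℚ)))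
      (harmonic (p - 1) / (p : ℚ) ^ 3)) ∧
    RatModEq p
      (∑ k ∈ Finset.Icc 1 (p - 1), (Nat.choose (2 * k) k : ℚ) / (k : ℚ) ^ 3)
      (-2 * harmonic (p - 1) / (p : ℚ) ^ 2) := by
  have : Fact p.Prime := ⟨hp⟩
  have hp0 : (p : ℚ) ≠ 0 := by exact_mod_cast hp.ne_zero
  have hlarge : p ≠ 5 → 5 < p := fun h => by
    have : p ≠ 4 := by rintro rfl; revert hp; decide
    omega
  have hfirst : p ≠ 5 → PowDvd p 1 (invBinomSum p 4 - harmonic (p - 1) / (p : ℚ) ^ 3) := fun h => by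
    refine PowDvd.of_pow_mul (n := 3) (k := 4) (.of_eq (powDvd_invBinomSum_four (hlarge h)) ?_)
    rw [harmonic_pred_eq_hsum]
    field_simp
  refine ⟨fun h => ?_, ?_⟩
  · have hs : ∑ k ∈ Finset.Icc 1 (p - 1), 1 / ((k : ℚ) ^ 4 * (Nat.choose (2 * k) k : ℚ)) =
        invBinomSum p 4 := by
      rw [sum_Icc_one_pred_eq]
      refine sum_congr rfl fun k _ => ?_
      rw [Nat.centralBinom_eq_two_mul_choose]
      push_cast
      field_simp
    rw [hs]
    exact (hfirst h).ratModEq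
  · by_cases h : p = 5
    · subst h
      exact ratModEq_five
    · have hs : ∑ k ∈ Finset.Icc 1 (p - 1), (Nat.choose (2 * k) k : ℚ) / (k : ℚ) ^ 3 =
          ∑ k ∈ range (p - 1), ((k + 1).centralBinom : ℚ) / ((k : ℚ) + 1) ^ 3 := by
        rw [sum_Icc_one_pred_eq]
        refine sum_congr rfl fun k _ => ?_
        rw [Nat.centralBinom_eq_two_mul_choose]
        push_cast
        rfl
      rw [hs]
      -- The first congruence times 2p turns -2p I_4 into -2H_1/p², with a power of p to spare.
      have h1 := (PowDvd.pow_mul' (n := 1) (hfirst h)).mul_int (PowDvd.natCast 2)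
      refine PowDvd.ratModEq (.of_eq ((powDvd_sum_centralBinom_div_cube (hlarge h)).sub
        (h1.mono (by norm_num))) ?_)
      push_cast
      field_simp
      ring
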